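/- Let $(M,g)$ and $(\bar M,\bar g)$ be smooth finite-dimensional Riemannian manifolds, let $\mathcal D\subset TM$ and $\bar{\mathcal D}\subset T\bar M$ be smooth distributions (subbundles), and let $f:M\to\bar M$ be a smooth isometric immersion that is adapted, i.e. $f_*(\mathcal D)\subset\bar{\mathcal D}$ along $f(M)$. Suppose $\mathcal D=\mathcal D_1\oplus\mathcal D_2$ with mutually orthogonal smooth distributions $\mathcal D_1,\mathcal D_2$ of ranks $n_1,n_2>0$. Let $R_{X,Y}=[\nabla_X,\nabla_Y]-\nabla_{[X,Y]}$ be the curvature tensor of $g$. For mutually orthogonal subspaces $V_1,V_2$ of a tangent space, with orthonormal bases $(e_a)$ of $V_1$ and $(e'_b)$ of $V_2$, define the mutual curvature $$\mathrm S_{\mathrm m}(V_1,V_2)=\sum_{a,b}g(R_{e_a,e'_b}\,e'_b,e_a),$$ the sum of the sectional curvatures $K(e_a\wedge e'_b)$; let $\bar{\mathrm S}_{\mathrm m}$ be the analogue for $(\bar M,\bar g)$. For $y\in\bar M$ let $$\bar\delta^+_{\mathrm m,\bar{\mathcal D}}(n_1,n_2)(y)=\max\bar{\mathrm S}_{\mathrm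 m}(V_1,V_2),$$ where $V_1,V_2$ run over all mutually orthogonal subspaces of $\bar{\mathcal D}_y$ with $\dim V_i=n_i$. Let $\bar h(X,Y)=(\bar\nabla_X f_*Y)^{\perp}$ be the second fundamental form of $f$, and for a subspace $V\subset T_xM$ with orthonormal basis $(e_i)$ let $\bar H_V=\sum_i\bar h(e_i,e_i)$; write $\bar H_{\mathcal D}(x)=\bar H_{\mathcal D_x}$ and $\bar H_i(x)=\bar H_{\mathcal D_i(x)}$. Then at every $x\in M$ (the above maximum being attained at $y=f(x)$) $$\mathrm S_{\mathrm m}(\mathcal D_1(x),\mathcal D_2(x))\le\tfrac14\,\|\bar H_{\mathcal D}(x)\|^2+\bar\delta^+_{\mathrm m,\bar{\mathcal D}}(n_1,n_2)(f(x)).$$ Equality holds at $x$ if and only if the following three conditions hold: $f$ is mixed totally geodesic on $\mathcal D_x$, i.e. $\bar h(X,Y)=0$ for all $X\in\mathcal D_1(x)$, $Y\in\mathcal D_2(x)$; $\bar H_1(x)=\bar H_2(x)$; and $\bar{\mathrm S}_{\mathrm m}(f_*\mathcal D_1(x),f_*\mathcal D_2(x))=\bar\delta^+_{\mathrm m,\bar{\mathcal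 D}}(n_1,n_2)(f(x))$. -/

import Mathlib

open Set Topology Bundle
open scoped Manifold ContDiff InnerProductSpace

noncomputable section

namespace SubRiemannian

/-! ### Levi-Civita calculus of a metric on (an open subset of) a vector space

A metric is a map `G` from points of `E` to bilinear forms on `E`. -/

section Coordinates

variable {E : Type*} [NormedAddCommGroup E] [NormedSpace ℝ E]

/-- The covector `z ↦ (D_v G (w, z) + D_w G (v, z) - D_z G (v, w)) / 2` at the point `p`
(Christoffel symbols of the first kind). -/
def christoffelFirst (G : E → E →L[ℝ] E →L[ℝ] ℝ) (p v w : E) : E →L[ℝ] ℝ :=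
  (1 / 2 : ℝ) • (fderiv ℝ G p v w + fderiv ℝ G p w v - ((fderiv ℝ G p).flip v).flip w)

/-- Christoffel symbols `Γ_p(v, w)` of the Levi-Civita connection: the vector which the form `G p`
turns into the covector `christoffelFirst G p v w`. (`ContinuousLinearMap.inverse` is the true
inverse of `G p : E → E*` wherever `G p` is positive definite and `E` is finite dimensional.) -/
def christoffel (G : E → E →L[ℝ] E →L[ℝ] ℝ) (p v w : E) : E :=
  (G p).inverse (christoffelFirst G p v w)

/-- The Levi-Civita covariant derivative `∇_X Y` of vector fields on `E`. -/
def covDeriv (G : E → E →L[ℝ] E →L[ℝ] ℝ) (X Y : E → E) (p : E) : E :=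
  fderiv ℝ Y p (X p) + christoffel G p (X p) (Y p)

/-- The curvature `R_{X,Y} Z = ∇_X ∇_Y Z - ∇_Y ∇_X Z - ∇_{[X,Y]} Z` at `p`, computed with the
constant vector fields `X = u`, `Y = v`, `Z = w`, for which `[X, Y] = 0`. -/
def coordCurvature (G : E → E →L[ℝ] E →L[ℝ] ℝ) (p u v w : E) : E :=
  covDeriv G (fun _ => u) (covDeriv G (fun _ => v) (fun _ => w)) p
    - covDeriv G (fun _ => v) (covDeriv G (fun _ => u) (fun _ => w)) p

end Coordinates

/-! ### Riemannian manifolds -/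

section Manifold

variable {E : Type*} [NormedAddCommGroup E] [NormedSpace ℝ E]
  {M : Type*} [TopologicalSpace M] [ChartedSpace E M] [IsManifold 𝓘(ℝ, E) ∞ M]

/-- Tangent spaces of a finite-dimensional manifold are finite dimensional. -/
instance finiteDimensional_tangentSpace [FiniteDimensional ℝ E] (x : M) :
    FiniteDimensional ℝ (TangentSpace 𝓘(ℝ, E) x) :=
  inferInstanceAs (FiniteDimensional ℝ E)

variable (E) in
/-- A smooth distribution of rank `d` on `M`, i.e. a rank `d` smooth subbundle of `TM`: a family of
`d`-dimensional subspaces of the tangent spaces, locally spanned by `d` smooth vector fields. -/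
structure Distribution (M : Type*) [TopologicalSpace M] [ChartedSpace E M]
    [IsManifold 𝓘(ℝ, E) ∞ M] (d : ℕ) where
  /-- The subspace of the tangent space at each point. -/
  fiber : ∀ x : M, Submodule ℝ (TangentSpace 𝓘(ℝ, E) x)
  finrank_fiber : ∀ x, Module.finrank ℝ (fiber x) = d
  smooth : ∀ x, ∃ U ∈ 𝓝 x, ∃ X : Fin d → ∀ y : M, TangentSpace 𝓘(ℝ, E) y,
    (∀ i, ContMDiffOn 𝓘(ℝ, E) 𝓘(ℝ, E).tangent ∞
      (fun y => (⟨y, X i y⟩ : TangentBundle 𝓘(ℝ, E) M)) U) ∧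
    ∀ y ∈ U, fiber y = Submodule.span ℝ (range fun i => X i y)

variable [RiemannianBundle (fun x : M => TangentSpace 𝓘(ℝ, E) x)]

/-- The Riemannian metric of `M` in the preferred chart around `x`, as a field of bilinear forms on
the model space: the pullback of the metric under the inverse chart. -/
def chartMetric (x : M) (p : E) : E →L[ℝ] E →L[ℝ] ℝ :=
  let A : E →L[ℝ] TangentSpace 𝓘(ℝ, E) ((extChartAt 𝓘(ℝ, E) x).symm p) :=
    mfderiv 𝓘(ℝ, E) 𝓘(ℝ, E) (extChartAt 𝓘(ℝ, E) x).symm p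
  (innerSL ℝ (E := TangentSpace 𝓘(ℝ, E) ((extChartAt 𝓘(ℝ, E) x).symm p))).bilinearComp A A

/-- The Riemann curvature tensor `R_{u,v} w` at `x`, computed in the preferred chart around `x`,
whose differential at `x` is the identity of `TangentSpace 𝓘(ℝ, E) x = E`. -/
def curvature (x : M) (u v w : TangentSpace 𝓘(ℝ, E) x) : TangentSpace 𝓘(ℝ, E) x :=
  coordCurvature (chartMetric (E := E) x) (extChartAt 𝓘(ℝ, E) x x) (u : E) (v : E) (w : E)

/-- `g(R_{u,v} v, u)`, the sectional curvature of the plane `u ∧ v` for orthonormal `u`, `v`. -/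
def sectionalCurvature (x : M) (u v : TangentSpace 𝓘(ℝ, E) x) : ℝ :=
  ⟪curvature (E := E) x u v v, u⟫_ℝ

variable [FiniteDimensional ℝ E]

/-- The mutual curvature `S_m(V, W) = ∑_{a, b} K(e_a, e'_b)` of two orthogonal subspaces of
`T_x M`, with `(e_a)`, `(e'_b)` orthonormal bases of `V`, `W` (it does not depend on them). -/
def mutualCurvature (x : M) (V W : Submodule ℝ (TangentSpace 𝓘(ℝ, E) x)) : ℝ :=
  ∑ a, ∑ b, sectionalCurvature (E := E) x (stdOrthonormalBasis ℝ V a : TangentSpace 𝓘(ℝ, E) x)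
    (stdOrthonormalBasis ℝ W b : TangentSpace 𝓘(ℝ, E) x)

/-- The values `S_m(V, W)` for all mutually orthogonal subspaces `V`, `W` of `D_x` of dimensions
`n₁`, `n₂`. -/
def mutualCurvatureValues {d : ℕ} (D : Distribution E M d) (n₁ n₂ : ℕ) (x : M) : Set ℝ :=
  {s | ∃ V W : Submodule ℝ (TangentSpace 𝓘(ℝ, E) x), V ≤ D.fiber x ∧ W ≤ D.fiber x ∧ V ⟂ W ∧
    Module.finrank ℝ V = n₁ ∧ Module.finrank ℝ W = n₂ ∧ s = mutualCurvature x V W}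

/-- The invariant `δ⁺_{m,D}(n₁, n₂)(x)`: the largest mutual curvature of mutually orthogonal
subspaces of `D_x` of dimensions `n₁`, `n₂`. -/
def deltaPlus {d : ℕ} (D : Distribution E M d) (n₁ n₂ : ℕ) (x : M) : ℝ :=
  sSup (mutualCurvatureValues D n₁ n₂ x)

end Manifold

/-! ### Isometric immersions -/

section Immersion

variable {E : Type*} [NormedAddCommGroup E] [NormedSpace ℝ E]
  {M : Type*} [TopologicalSpace M] [ChartedSpace E M] [IsManifold 𝓘(ℝ, E) ∞ M]
  [RiemannianBundle (fun x : M => TangentSpace 𝓘(ℝ, E) x)]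
  {E' : Type*} [NormedAddCommGroup E'] [NormedSpace ℝ E']
  {M' : Type*} [TopologicalSpace M'] [ChartedSpace E' M'] [IsManifold 𝓘(ℝ, E') ∞ M']
  [RiemannianBundle (fun y : M' => TangentSpace 𝓘(ℝ, E') y)]

/-- A smooth map whose differential preserves the inner products (so it is an immersion). -/
structure IsIsometricImmersion (f : M → M') : Prop where
  contMDiff : ContMDiff 𝓘(ℝ, E) 𝓘(ℝ, E') ∞ f
  inner_mfderiv : ∀ (x : M) (v w : TangentSpace 𝓘(ℝ, E) x),
    ⟪mfderiv 𝓘(ℝ, E) 𝓘(ℝ, E') f x v, mfderiv 𝓘(ℝ, E) 𝓘(ℝ, E') f x w⟫_ℝ = ⟪v, w⟫_ℝ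

/-- `f` is adapted to the distributions `D`, `D'` if `f_*(D) ⊆ D'` along `f(M)`. -/
def IsAdapted {d d' : ℕ} (f : M → M') (D : Distribution E M d) (D' : Distribution E' M' d') :
    Prop :=
  ∀ x, ∀ v ∈ D.fiber x, mfderiv 𝓘(ℝ, E) 𝓘(ℝ, E') f x v ∈ D'.fiber (f x)

/-- The ambient Levi-Civita derivative `∇'_v (f_* W)` at `f x` of the vector field `f_* W` along
`f`, where `W` is the extension of `w` which is constant in the preferred chart around `x`; all is
computed in the preferred charts around `x` and `f x`. -/
def ambientDeriv (f : M → M') (x : M) (v w : TangentSpace 𝓘(ℝ, E) x) :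
    TangentSpace 𝓘(ℝ, E') (f x) :=
  let φ : E → E' := writtenInExtChartAt 𝓘(ℝ, E) 𝓘(ℝ, E') x f
  let p : E := extChartAt 𝓘(ℝ, E) x x
  let v₀ : E := v
  let w₀ : E := w
  fderiv ℝ (fun u => fderiv ℝ φ u w₀) p v₀
    + christoffel (chartMetric (E := E') (f x)) (φ p) (fderiv ℝ φ p v₀) (fderiv ℝ φ p w₀)

variable [FiniteDimensional ℝ E] [FiniteDimensional ℝ E']

/-- The second fundamental form `h'(v, w)` of `f` at `x`: the component of `∇'_v (f_* W)` normal to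
`f_*(T_x M)`. -/
def secondFundamentalForm (f : M → M') (x : M) (v w : TangentSpace 𝓘(ℝ, E) x) :
    TangentSpace 𝓘(ℝ, E') (f x) :=
  ((mfderiv 𝓘(ℝ, E) 𝓘(ℝ, E') f x).range)ᗮ.starProjection
    (ambientDeriv (E' := E') f x v w)

/-- The mean curvature vector `H'_V = ∑ i, h'(e_i, e_i)` of a subspace `V` of `T_x M`, with
`(e_i)` an orthonormal basis of `V` (it does not depend on the basis). -/
def meanCurvature (f : M → M') (x : M) (V : Submodule ℝ (TangentSpace 𝓘(ℝ, E) x)) :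
    TangentSpace 𝓘(ℝ, E') (f x) :=
  ∑ i, secondFundamentalForm (E' := E') f x
    (stdOrthonormalBasis ℝ V i : TangentSpace 𝓘(ℝ, E) x)
    (stdOrthonormalBasis ℝ V i : TangentSpace 𝓘(ℝ, E) x)

/-- `f` is mixed totally geodesic on `V ⊕ W` if `h'(v, w) = 0` for all `v ∈ V`, `w ∈ W`. -/
def IsMixedTotallyGeodesic (f : M → M') (x : M) (V W : Submodule ℝ (TangentSpace 𝓘(ℝ, E) x)) :
    Prop :=
  ∀ v ∈ V, ∀ w ∈ W, secondFundamentalForm (E' := E') f x v w = 0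

end Immersion

end SubRiemannian

end

/-! The proof sums the Gauss equation over orthonormal bases of 𝒟₁ and 𝒟₂ (`mutualCurvature_eq`):
S_m(𝒟₁, 𝒟₂) = S̄_m(f_*𝒟₁, f_*𝒟₂) + ⟨H̄₁, H̄₂⟩ − ∑ ‖h̄(e_a, e'_b)‖². Orthogonality gives H̄_𝒟 = H̄₁ +
H̄₂, so ⟨H̄₁, H̄₂⟩ = ¼‖H̄_𝒟‖² − ¼‖H̄₁ − H̄₂‖². As f is adapted and isometric, (f_*𝒟₁, f_*𝒟₂)
competes in the definition of δ̄⁺. The right side of the inequality minus the left is therefore a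
sum of three nonnegative terms, ¼‖H̄₁ − H̄₂‖², ∑ ‖h̄(e_a, e'_b)‖² and δ̄⁺ − S̄_m(f_*𝒟₁, f_*𝒟₂), and
equality means that all three vanish.

Most of the work is the Gauss equation. Curvature is defined by Christoffel symbols in a preferred
chart, so `gauss_aux` is proved first for a C³ map between vector spaces that pulls one metric back
to another, by differentiating the transformation law of the Christoffel symbols of the first kind;
`gauss_equation` transfers it to the manifolds. Independence of the bases follows from bilinearity
(`Orthonormal.sum_bilin_eq`), and the maximum is attained because orthonormal families in a fixed
subspace form a compact set (`isGreatest_deltaPlus`). -/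

noncomputable section

namespace SubRiemannian

/-! ### Levi-Civita calculus of a metric on a vector space -/

section CoordinateGauss

set_option maxSynthPendingDepth 3

variable {E : Type*} [NormedAddCommGroup E] [NormedSpace ℝ E]
  {F : Type*} [NormedAddCommGroup F] [NormedSpace ℝ F]

/-- A field of bilinear forms which near `p` is a pseudo-Riemannian metric of class `C²`. -/
structure IsMetricNear (G : E → E →L[ℝ] E →L[ℝ] ℝ) (p : E) : Prop where
  contDiffAt : ContDiffAt ℝ 2 G p
  symm : ∀ᶠ q in 𝓝 p, ∀ v w, G q v w = G q w v
  isInvertible : (G p).IsInvertible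

theorem christoffelFirst_apply (G : E → E →L[ℝ] E →L[ℝ] ℝ) (p v w z : E) :
    christoffelFirst G p v w z =
      1 / 2 * (fderiv ℝ G p v w z + fderiv ℝ G p w v z - fderiv ℝ G p z v w) := by
  simp [christoffelFirst]

theorem christoffelFirst_comm (G : E → E →L[ℝ] E →L[ℝ] ℝ) (p v w : E)
    (h : ∀ u v w, fderiv ℝ G p u v w = fderiv ℝ G p u w v) :
    christoffelFirst G p v w = christoffelFirst G p w v := by
  ext z
  rw [christoffelFirst_apply, christoffelFirst_apply, h z v w]
  ring

namespace IsMetricNear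

variable {G : E → E →L[ℝ] E →L[ℝ] ℝ} {p : E}

theorem differentiableAt (hG : IsMetricNear G p) : DifferentiableAt ℝ G p :=
  hG.contDiffAt.differentiableAt (by norm_num)

theorem differentiableAt_fderiv (hG : IsMetricNear G p) : DifferentiableAt ℝ (fderiv ℝ G) p :=
  (hG.contDiffAt.fderiv_right (m := 1) (by norm_num)).differentiableAt (by norm_num)

theorem eventually_isInvertible [CompleteSpace E] (hG : IsMetricNear G p) :
    ∀ᶠ q in 𝓝 p, (G q).IsInvertible := by
  obtain ⟨e, he⟩ := hG.isInvertible
  exact hG.contDiffAt.continuousAt (he ▸ e.nhds)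

theorem fderiv_comm (hG : IsMetricNear G p) (u v w : E) :
    fderiv ℝ G p u v w = fderiv ℝ G p u w v := by
  have h : ∀ a b, HasFDerivAt (fun q => G q a b)
      ((ContinuousLinearMap.apply ℝ ℝ b).comp
        ((ContinuousLinearMap.apply ℝ (E →L[ℝ] ℝ) a).comp (fderiv ℝ G p))) p := fun a b =>
    (ContinuousLinearMap.apply ℝ ℝ b).hasFDerivAt.comp p
      ((ContinuousLinearMap.apply ℝ (E →L[ℝ] ℝ) a).hasFDerivAt.comp p
        hG.differentiableAt.hasFDerivAt)
  have h' := (h w v).congr_of_eventuallyEq (f₁ := fun q => G q v w)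
    (hG.symm.mono fun q hq => hq v w)
  exact DFunLike.congr_fun ((h v w).unique h') u

/-- All three conditions are open, invertibility because invertible operators form an open set.
Pointwise identities for Christoffel symbols thus hold near `p` and may be differentiated. -/
theorem eventually_nhds (hG : IsMetricNear G p) [CompleteSpace E] :
    ∀ᶠ q in 𝓝 p, IsMetricNear G q := by
  filter_upwards [hG.contDiffAt.eventually (by simp), hG.symm.eventually_nhds,
    hG.eventually_isInvertible] with q h₁ h₂ h₃
  exact ⟨h₁, h₂, h₃⟩

theorem christoffelFirst_symm (hG : IsMetricNear G p) (v w : E) :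
    christoffelFirst G p v w = christoffelFirst G p w v :=
  christoffelFirst_comm G p v w hG.fderiv_comm

theorem christoffel_symm (hG : IsMetricNear G p) (v w : E) :
    christoffel G p v w = christoffel G p w v := by
  rw [christoffel, hG.christoffelFirst_symm, christoffel]

theorem apply_comm (hG : IsMetricNear G p) (v w : E) : G p v w = G p w v :=
  hG.symm.self_of_nhds v w

theorem apply_christoffel (hG : IsMetricNear G p) (v w z : E) :
    G p (christoffel G p v w) z = christoffelFirst G p v w z := by
  rw [christoffel, hG.isInvertible.self_apply_inverse]

/-- The Levi-Civita connection is metric. -/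
theorem fderiv_eq (hG : IsMetricNear G p) (u v w : E) :
    fderiv ℝ G p u v w = christoffelFirst G p u v w + christoffelFirst G p u w v := by
  rw [christoffelFirst_apply, christoffelFirst_apply]
  linarith [hG.fderiv_comm u v w, hG.fderiv_comm v w u, hG.fderiv_comm w u v]

theorem differentiableAt_christoffelFirst (hG : IsMetricNear G p) (v w : E) :
    DifferentiableAt ℝ (fun q => christoffelFirst G q v w) p := by
  have h := hG.differentiableAt_fderiv
  have h₀ : DifferentiableAt ℝ (fun q => fderiv ℝ G q v w + fderiv ℝ G q w v) p :=
    (h.clm_apply (differentiableAt_const v)).clm_apply (differentiableAt_const w) |>.add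
      ((h.clm_apply (differentiableAt_const w)).clm_apply (differentiableAt_const v))
  have h₁ : DifferentiableAt ℝ (fun q => (fderiv ℝ G q).flip) p :=
    (ContinuousLinearMap.flipₗᵢ ℝ E E (E →L[ℝ] ℝ)).toContinuousLinearEquiv
      |>.toContinuousLinearMap.differentiableAt.comp p h
  have h₂ : DifferentiableAt ℝ (fun q => (fderiv ℝ G q).flip v) p :=
    h₁.clm_apply (differentiableAt_const v)
  have h₃ : DifferentiableAt ℝ (fun q => ((fderiv ℝ G q).flip v).flip) p :=
    (ContinuousLinearMap.flipₗᵢ ℝ E E ℝ).toContinuousLinearEquiv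
      |>.toContinuousLinearMap.differentiableAt.comp p h₂
  exact (h₀.sub (h₃.clm_apply (differentiableAt_const w))).const_smul (1 / 2 : ℝ)

theorem differentiableAt_christoffel [CompleteSpace E] (hG : IsMetricNear G p) (v w : E) :
    DifferentiableAt ℝ (fun q => christoffel G q v w) p := by
  have h : DifferentiableAt ℝ (fun q => (G q).inverse) p :=
    (hG.isInvertible.contDiffAt_map_inverse (n := 1)).differentiableAt (by norm_num)
      |>.comp p hG.differentiableAt
  exact h.clm_apply (hG.differentiableAt_christoffelFirst v w)

/-- Product rule applied to `apply_christoffel`; this avoids an explicit derivative of the inverse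
metric. -/
theorem apply_fderiv_christoffel [CompleteSpace E] (hG : IsMetricNear G p) (u v w z : E) :
    G p (fderiv ℝ (fun q => christoffel G q v w) p u) z =
      fderiv ℝ (fun q => christoffelFirst G q v w) p u z
        - fderiv ℝ G p u (christoffel G p v w) z := by
  have h₁ := hG.differentiableAt.hasFDerivAt.clm_apply
    (hG.differentiableAt_christoffel v w).hasFDerivAt
  have h₂ := (hG.differentiableAt_christoffelFirst v w).hasFDerivAt.congr_of_eventuallyEq
    (f₁ := fun q => G q (christoffel G q v w)) (hG.eventually_nhds.mono fun q hq => by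
      ext z; exact hq.apply_christoffel v w z)
  have h₃ := DFunLike.congr_fun (DFunLike.congr_fun (h₁.unique h₂) u) z
  simp only [add_apply, ContinuousLinearMap.comp_apply,
    ContinuousLinearMap.flip_apply] at h₃
  linarith

/-- In this form linearity in each of `u`, `v`, `w`, `z` is visible, which later gives the
tensoriality and continuity of the curvature. -/
theorem fderiv_christoffelFirst_apply (hG : IsMetricNear G p) (u v w z : E) :
    fderiv ℝ (fun q => christoffelFirst G q v w) p u z =
      1 / 2 * (fderiv ℝ (fderiv ℝ G) p u v w z + fderiv ℝ (fderiv ℝ G) p u w v z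
        - fderiv ℝ (fderiv ℝ G) p u z v w) := by
  have h := hG.differentiableAt_fderiv.hasFDerivAt
  have h₁ : ∀ a b c, HasFDerivAt (fun q => fderiv ℝ G q a b c)
      ((ContinuousLinearMap.apply ℝ ℝ c).comp ((ContinuousLinearMap.apply ℝ (E →L[ℝ] ℝ) b).comp
        ((ContinuousLinearMap.apply ℝ (E →L[ℝ] E →L[ℝ] ℝ) a).comp
          (fderiv ℝ (fderiv ℝ G) p)))) p := fun a b c =>
    (ContinuousLinearMap.apply ℝ ℝ c).hasFDerivAt.comp p
      ((ContinuousLinearMap.apply ℝ (E →L[ℝ] ℝ) b).hasFDerivAt.comp p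
        ((ContinuousLinearMap.apply ℝ (E →L[ℝ] E →L[ℝ] ℝ) a).hasFDerivAt.comp p h))
  have h₂ := (((h₁ v w z).add (h₁ w v z)).sub (h₁ z v w)).const_mul (1 / 2)
  have h₃ := (ContinuousLinearMap.apply ℝ ℝ z).hasFDerivAt.comp p
    (hG.differentiableAt_christoffelFirst v w).hasFDerivAt
  have h₄ := h₂.congr_of_eventuallyEq (f₁ := fun q => christoffelFirst G q v w z)
    (Filter.Eventually.of_forall fun q => christoffelFirst_apply G q v w z)
  simpa using DFunLike.congr_fun (h₃.unique h₄) u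

/-- The curvature tensor with all indices lowered, in terms of Christoffel symbols. -/
theorem apply_coordCurvature [CompleteSpace E] (hG : IsMetricNear G p) (u v w z : E) :
    G p (coordCurvature G p u v w) z =
      fderiv ℝ (fun q => christoffelFirst G q v w) p u z
        - fderiv ℝ (fun q => christoffelFirst G q u w) p v z
        - G p (christoffel G p v w) (christoffel G p u z)
        + G p (christoffel G p u w) (christoffel G p v z) := by
  have key : ∀ a b, G p (covDeriv G (fun _ => a) (covDeriv G (fun _ => b) (fun _ => w)) p) z =
      fderiv ℝ (fun q => christoffelFirst G q b w) p a z
        - G p (christoffel G p b w) (christoffel G p a z) := by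
    intro a b
    have hc : covDeriv G (fun _ => b) (fun _ => w) = fun q => christoffel G q b w := by
      ext q; simp [covDeriv]
    rw [hc]
    simp only [covDeriv, map_add, add_apply]
    -- By metric compatibility, the term Γ(a, Γ(b, w)) cancels half of the derivative of `G`; what
    -- remains is −G(Γ(b, w), Γ(a, z)).
    rw [hG.apply_fderiv_christoffel, hG.apply_christoffel, hG.fderiv_eq,
      ← hG.apply_christoffel a z, hG.apply_comm (christoffel G p a z)]
    ring
  simp only [coordCurvature, map_sub, sub_apply, key]
  ring

end IsMetricNear

end CoordinateGauss

end SubRiemannian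

namespace SubRiemannian

/-! ### The Gauss equation for a pulled-back metric, in coordinates -/

section CoordinateGauss

set_option maxSynthPendingDepth 3

variable {E : Type*} [NormedAddCommGroup E] [NormedSpace ℝ E]
  {F : Type*} [NormedAddCommGroup F] [NormedSpace ℝ F]

theorem fderiv_bilin {T : E → F →L[ℝ] F →L[ℝ] ℝ} {A B : E → F} {p : E}
    (hT : DifferentiableAt ℝ T p) (hA : DifferentiableAt ℝ A p) (hB : DifferentiableAt ℝ B p) :
    DifferentiableAt ℝ (fun q => T q (A q) (B q)) p ∧ ∀ u,
      fderiv ℝ (fun q => T q (A q) (B q)) p u =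
        fderiv ℝ T p u (A p) (B p) + T p (fderiv ℝ A p u) (B p) + T p (A p) (fderiv ℝ B p u) := by
  have h := (hT.hasFDerivAt.clm_apply hA.hasFDerivAt).clm_apply hB.hasFDerivAt
  refine ⟨h.differentiableAt, fun u => ?_⟩
  rw [h.fderiv]
  simp only [add_apply, ContinuousLinearMap.comp_apply, ContinuousLinearMap.flip_apply]
  ring

theorem fderiv_trilin {T : E → F →L[ℝ] F →L[ℝ] F →L[ℝ] ℝ} {A B C : E → F} {p : E}
    (hT : DifferentiableAt ℝ T p) (hA : DifferentiableAt ℝ A p) (hB : DifferentiableAt ℝ B p)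
    (hC : DifferentiableAt ℝ C p) :
    DifferentiableAt ℝ (fun q => T q (A q) (B q) (C q)) p ∧ ∀ u,
      fderiv ℝ (fun q => T q (A q) (B q) (C q)) p u =
        fderiv ℝ T p u (A p) (B p) (C p) + T p (fderiv ℝ A p u) (B p) (C p)
          + T p (A p) (fderiv ℝ B p u) (C p) + T p (A p) (B p) (fderiv ℝ C p u) := by
  have h := ((hT.hasFDerivAt.clm_apply hA.hasFDerivAt).clm_apply hB.hasFDerivAt).clm_apply
    hC.hasFDerivAt
  refine ⟨h.differentiableAt, fun u => ?_⟩
  rw [h.fderiv]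
  simp only [add_apply, ContinuousLinearMap.comp_apply, ContinuousLinearMap.flip_apply]
  ring

/-- `φ` is a `C³` map which near `p` pulls the metric `G'` back to `G`. -/
structure IsPullbackNear (G : E → E →L[ℝ] E →L[ℝ] ℝ) (G' : F → F →L[ℝ] F →L[ℝ] ℝ)
    (φ : E → F) (p : E) : Prop where
  domain : IsMetricNear G p
  target : IsMetricNear G' (φ p)
  contDiffAt : ContDiffAt ℝ 3 φ p
  pullback : ∀ᶠ q in 𝓝 p, ∀ v w, G q v w = G' (φ q) (fderiv ℝ φ q v) (fderiv ℝ φ q w)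

/-- The ambient covariant derivative, along `φ`, of the image of a constant vector field. -/
def coordAmbientDeriv (G' : F → F →L[ℝ] F →L[ℝ] ℝ) (φ : E → F) (p v w : E) : F :=
  fderiv ℝ (fderiv ℝ φ) p v w + christoffel G' (φ p) (fderiv ℝ φ p v) (fderiv ℝ φ p w)

namespace IsPullbackNear

variable {G : E → E →L[ℝ] E →L[ℝ] ℝ} {G' : F → F →L[ℝ] F →L[ℝ] ℝ} {φ : E → F} {p : E}

theorem eventually_nhds [CompleteSpace E] [CompleteSpace F] (h : IsPullbackNear G G' φ p) :
    ∀ᶠ q in 𝓝 p, IsPullbackNear G G' φ q := by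
  filter_upwards [h.domain.eventually_nhds,
    h.contDiffAt.continuousAt.eventually h.target.eventually_nhds,
    h.contDiffAt.eventually (by simp), h.pullback.eventually_nhds] with q h₁ h₂ h₃ h₄
  exact ⟨h₁, h₂, h₃, h₄⟩

theorem differentiableAt (h : IsPullbackNear G G' φ p) : DifferentiableAt ℝ φ p :=
  h.contDiffAt.differentiableAt (by norm_num)

theorem contDiffAt_fderiv (h : IsPullbackNear G G' φ p) : ContDiffAt ℝ 2 (fderiv ℝ φ) p :=
  h.contDiffAt.fderiv_right (by norm_num)

theorem differentiableAt_fderiv (h : IsPullbackNear G G' φ p) :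
    DifferentiableAt ℝ (fderiv ℝ φ) p :=
  h.contDiffAt_fderiv.differentiableAt (by norm_num)

theorem differentiableAt_fderiv_fderiv (h : IsPullbackNear G G' φ p) :
    DifferentiableAt ℝ (fderiv ℝ (fderiv ℝ φ)) p :=
  (h.contDiffAt_fderiv.fderiv_right (m := 1) (by norm_num)).differentiableAt (by norm_num)

theorem fderiv_fderiv_comm (h : IsPullbackNear G G' φ p) (v w : E) :
    fderiv ℝ (fderiv ℝ φ) p v w = fderiv ℝ (fderiv ℝ φ) p w v :=
  (h.contDiffAt.isSymmSndFDerivAt (by simp; norm_num)).eq v w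

theorem fderiv_fderiv_fderiv_comm (h : IsPullbackNear G G' φ p) (u v : E) :
    fderiv ℝ (fderiv ℝ (fderiv ℝ φ)) p u v = fderiv ℝ (fderiv ℝ (fderiv ℝ φ)) p v u :=
  (h.contDiffAt_fderiv.isSymmSndFDerivAt (by simp)).eq u v

theorem fderiv_apply (h : DifferentiableAt ℝ (fderiv ℝ φ) p) (v u : E) :
    fderiv ℝ (fun q => fderiv ℝ φ q v) p u = fderiv ℝ (fderiv ℝ φ) p u v := by
  rw [(h.hasFDerivAt.clm_apply (hasFDerivAt_const v p)).fderiv]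
  simp

theorem fderiv_metric (h : IsPullbackNear G G' φ p) (u v w : E) :
    fderiv ℝ G p u v w =
      fderiv ℝ G' (φ p) (fderiv ℝ φ p u) (fderiv ℝ φ p v) (fderiv ℝ φ p w)
        + G' (φ p) (fderiv ℝ (fderiv ℝ φ) p u v) (fderiv ℝ φ p w)
        + G' (φ p) (fderiv ℝ φ p v) (fderiv ℝ (fderiv ℝ φ) p u w) := by
  have hd := h.differentiableAt_fderiv
  have h₁ := (fderiv_bilin h.domain.differentiableAt (differentiableAt_const v)
    (differentiableAt_const w)).2 u
  have h₂ := (fderiv_bilin (h.target.differentiableAt.comp p h.differentiableAt)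
    (hd.clm_apply (differentiableAt_const v)) (hd.clm_apply (differentiableAt_const w))).2 u
  have h₃ : (fun q => G q v w) =ᶠ[𝓝 p]
      fun q => (G' ∘ φ) q (fderiv ℝ φ q v) (fderiv ℝ φ q w) :=
    h.pullback.mono fun q hq => hq v w
  rw [h₃.fderiv_eq, h₂, fderiv_apply hd, fderiv_apply hd,
    fderiv_comp p h.target.differentiableAt h.differentiableAt] at h₁
  simpa using h₁.symm

/-- Differentiating the pullback yields six terms with D²φ; in the Christoffel combination four
cancel by symmetry, and the two containing D²φ(v, w) add up. -/
theorem christoffelFirst_eq (h : IsPullbackNear G G' φ p) (v w z : E) :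
    christoffelFirst G p v w z =
      G' (φ p) (fderiv ℝ (fderiv ℝ φ) p v w) (fderiv ℝ φ p z)
        + christoffelFirst G' (φ p) (fderiv ℝ φ p v) (fderiv ℝ φ p w) (fderiv ℝ φ p z) := by
  rw [christoffelFirst_apply, christoffelFirst_apply, h.fderiv_metric, h.fderiv_metric,
    h.fderiv_metric, h.fderiv_fderiv_comm w v, h.fderiv_fderiv_comm z v,
    h.fderiv_fderiv_comm z w, h.target.apply_comm (fderiv ℝ φ p w),
    h.target.apply_comm (fderiv ℝ φ p v) (fderiv ℝ (fderiv ℝ φ) p w z)]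
  ring

/-- The tangential part of the ambient covariant derivative is the intrinsic one. -/
theorem apply_coordAmbientDeriv (h : IsPullbackNear G G' φ p) (v w z : E) :
    G' (φ p) (coordAmbientDeriv G' φ p v w) (fderiv ℝ φ p z) = G p (christoffel G p v w) z := by
  rw [h.domain.apply_christoffel, h.christoffelFirst_eq, coordAmbientDeriv, map_add, add_apply,
    h.target.apply_christoffel]

/-- The derivative of the transformation law `christoffelFirst_eq`, which holds on a neighbourhood
of `p`. -/
theorem fderiv_christoffelFirst [CompleteSpace E] [CompleteSpace F]
    (h : IsPullbackNear G G' φ p) (u v w z : E) :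
    fderiv ℝ (fun q => christoffelFirst G q v w) p u z =
      fderiv ℝ G' (φ p) (fderiv ℝ φ p u) (fderiv ℝ (fderiv ℝ φ) p v w) (fderiv ℝ φ p z)
        + G' (φ p) (fderiv ℝ (fderiv ℝ (fderiv ℝ φ)) p u v w) (fderiv ℝ φ p z)
        + G' (φ p) (fderiv ℝ (fderiv ℝ φ) p v w) (fderiv ℝ (fderiv ℝ φ) p u z)
        + fderiv ℝ (fun q => christoffelFirst G' q (fderiv ℝ φ p v) (fderiv ℝ φ p w)) (φ p)
            (fderiv ℝ φ p u) (fderiv ℝ φ p z)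
        + christoffelFirst G' (φ p) (fderiv ℝ (fderiv ℝ φ) p u v) (fderiv ℝ φ p w)
            (fderiv ℝ φ p z)
        + christoffelFirst G' (φ p) (fderiv ℝ φ p v) (fderiv ℝ (fderiv ℝ φ) p u w)
            (fderiv ℝ φ p z)
        + christoffelFirst G' (φ p) (fderiv ℝ φ p v) (fderiv ℝ φ p w)
            (fderiv ℝ (fderiv ℝ φ) p u z) := by
  have hd := h.differentiableAt_fderiv
  have hφ : ∀ a, DifferentiableAt ℝ (fun q => fderiv ℝ φ q a) p :=
    fun a => hd.clm_apply (differentiableAt_const a)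
  have hφ₂ : DifferentiableAt ℝ (fun q => fderiv ℝ (fderiv ℝ φ) q v w) p :=
    (h.differentiableAt_fderiv_fderiv.clm_apply (differentiableAt_const v)).clm_apply
      (differentiableAt_const w)
  have hφ₃ : fderiv ℝ (fun q => fderiv ℝ (fderiv ℝ φ) q v w) p u =
      fderiv ℝ (fderiv ℝ (fderiv ℝ φ)) p u v w := by
    rw [((h.differentiableAt_fderiv_fderiv.hasFDerivAt.clm_apply
      (hasFDerivAt_const v p)).clm_apply (hasFDerivAt_const w p)).fderiv]
    simp
  have h₁ := fderiv_bilin (h.target.differentiableAt.comp p h.differentiableAt) hφ₂ (hφ z)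
  have hT : DifferentiableAt ℝ (fderiv ℝ G' ∘ φ) p :=
    h.target.differentiableAt_fderiv.comp p h.differentiableAt
  have h₂ := fun a b c => fderiv_trilin hT (hφ a) (hφ b) (hφ c)
  -- The target symbol is expanded into three values of the trilinear form DG', so that
  -- `fderiv_trilin` applies.
  have h₃ : (fun q => christoffelFirst G q v w z) =ᶠ[𝓝 p] fun q =>
      (G' ∘ φ) q (fderiv ℝ (fderiv ℝ φ) q v w) (fderiv ℝ φ q z)
        + 1 / 2 * ((fderiv ℝ G' ∘ φ) q (fderiv ℝ φ q v) (fderiv ℝ φ q w) (fderiv ℝ φ q z)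
          + (fderiv ℝ G' ∘ φ) q (fderiv ℝ φ q w) (fderiv ℝ φ q v) (fderiv ℝ φ q z)
          - (fderiv ℝ G' ∘ φ) q (fderiv ℝ φ q z) (fderiv ℝ φ q v) (fderiv ℝ φ q w)) :=
    h.eventually_nhds.mono fun q hq => by
      beta_reduce
      rw [hq.christoffelFirst_eq, christoffelFirst_apply]
      rfl
  have h₄ := h₁.1.hasFDerivAt.add ((((h₂ v w z).1.hasFDerivAt.add
    (h₂ w v z).1.hasFDerivAt).sub (h₂ z v w).1.hasFDerivAt).const_mul (1 / 2))
  have h₅ := ((h.domain.differentiableAt_christoffelFirst v w).hasFDerivAt.clm_apply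
    (hasFDerivAt_const z p)).unique (h₄.congr_of_eventuallyEq h₃)
  have h₆ := DFunLike.congr_fun h₅ u
  simp only [add_apply, sub_apply, smul_apply, zero_apply, ContinuousLinearMap.comp_apply,
    ContinuousLinearMap.flip_apply, map_zero, zero_add, h₁.2, (h₂ _ _ _).2, smul_eq_mul] at h₆
  simp only [hφ₃, fderiv_apply hd, ContinuousLinearMap.comp_apply, Function.comp_apply,
    fderiv_comp p h.target.differentiableAt h.differentiableAt,
    fderiv_comp p h.target.differentiableAt_fderiv h.differentiableAt] at h₆
  rw [h₆, h.target.fderiv_christoffelFirst_apply, christoffelFirst_apply, christoffelFirst_apply,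
    christoffelFirst_apply]
  ring

/-- The Gauss equation, with the tangential components not yet split off. -/
theorem gauss_aux [CompleteSpace E] [CompleteSpace F] (h : IsPullbackNear G G' φ p)
    (u v w z : E) :
    G p (coordCurvature G p u v w) z =
      G' (φ p) (coordCurvature G' (φ p) (fderiv ℝ φ p u) (fderiv ℝ φ p v) (fderiv ℝ φ p w))
          (fderiv ℝ φ p z)
        + (G' (φ p) (coordAmbientDeriv G' φ p v w) (coordAmbientDeriv G' φ p u z)
          - G p (christoffel G p v w) (christoffel G p u z))
        - (G' (φ p) (coordAmbientDeriv G' φ p u w) (coordAmbientDeriv G' φ p v z)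
          - G p (christoffel G p u w) (christoffel G p v z)) := by
  -- Antisymmetrising in `u`, `v` removes D³φ and the terms with D²φ(u, v). Metric compatibility
  -- turns DG' into Christoffel terms; half of these cancel, the rest complete the products of
  -- ambient derivatives.
  rw [h.domain.apply_coordCurvature, h.target.apply_coordCurvature, h.fderiv_christoffelFirst,
    h.fderiv_christoffelFirst, h.fderiv_fderiv_fderiv_comm v u, h.fderiv_fderiv_comm v u,
    h.target.fderiv_eq, h.target.fderiv_eq]
  simp only [coordAmbientDeriv, map_add, add_apply, h.target.apply_christoffel]
  simp only [h.target.apply_comm _ (christoffel _ _ _ _), h.target.apply_christoffel]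
  rw [h.target.christoffelFirst_symm (fderiv ℝ φ p v) (fderiv ℝ φ p z)]
  ring

end IsPullbackNear

end CoordinateGauss

end SubRiemannian

namespace SubRiemannian

/-! ### Maps and metrics read in preferred charts -/

section Map

variable {E : Type*} [NormedAddCommGroup E] [NormedSpace ℝ E]
  {M : Type*} [TopologicalSpace M] [ChartedSpace E M]
  {E' : Type*} [NormedAddCommGroup E'] [NormedSpace ℝ E']
  {M' : Type*} [TopologicalSpace M'] [ChartedSpace E' M']

theorem contDiffAt_writtenInExtChartAt {f : M → M'} (hf : ContMDiff 𝓘(ℝ, E) 𝓘(ℝ, E') ∞ f)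
    (x : M) : ContDiffAt ℝ ∞ (writtenInExtChartAt 𝓘(ℝ, E) 𝓘(ℝ, E') x f)
      (extChartAt 𝓘(ℝ, E) x x) := by
  have h := ((contMDiffAt_iff (I := 𝓘(ℝ, E)) (I' := 𝓘(ℝ, E'))).1 (hf x)).2
  simpa [contDiffWithinAt_univ] using! h

theorem fderiv_writtenInExtChartAt {f : M → M'} (hf : ContMDiff 𝓘(ℝ, E) 𝓘(ℝ, E') ∞ f)
    (x : M) (v : TangentSpace 𝓘(ℝ, E) x) :
    fderiv ℝ (writtenInExtChartAt 𝓘(ℝ, E) 𝓘(ℝ, E') x f) (extChartAt 𝓘(ℝ, E) x x) v =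
      mfderiv 𝓘(ℝ, E) 𝓘(ℝ, E') f x v := by
  have h := ((hf x).mdifferentiableAt (by simp)).mfderiv
  have hr : range 𝓘(ℝ, E) = univ := by simp
  rw [hr, fderivWithin_univ] at h
  exact (DFunLike.congr_fun h v).symm

end Map

section Charts

variable {E : Type*} [NormedAddCommGroup E] [NormedSpace ℝ E]
  {M : Type*} [TopologicalSpace M] [ChartedSpace E M]

theorem chart_target_mem_nhds {x : M} {p : E} (hp : p ∈ (extChartAt 𝓘(ℝ, E) x).target) :
    (extChartAt 𝓘(ℝ, E) x).target ∈ 𝓝 p :=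
  (isOpen_extChartAt_target x).mem_nhds hp

theorem chartMetric_apply [RiemannianBundle (fun x : M => TangentSpace 𝓘(ℝ, E) x)]
    (x : M) (p v w : E) :
    chartMetric (E := E) x p v w =
      ⟪mfderiv 𝓘(ℝ, E) 𝓘(ℝ, E) (extChartAt 𝓘(ℝ, E) x).symm p v,
        mfderiv 𝓘(ℝ, E) 𝓘(ℝ, E) (extChartAt 𝓘(ℝ, E) x).symm p w⟫_ℝ :=
  rfl

variable [IsManifold 𝓘(ℝ, E) ∞ M]

theorem mdifferentiableAt_chart_symm {x : M} {p : E}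
    (hp : p ∈ (extChartAt 𝓘(ℝ, E) x).target) :
    MDifferentiableAt 𝓘(ℝ, E) 𝓘(ℝ, E) (extChartAt 𝓘(ℝ, E) x).symm p :=
  ((contMDiffOn_extChartAt_symm (n := ∞) x).contMDiffAt
    (chart_target_mem_nhds hp)).mdifferentiableAt (by simp)

theorem mfderiv_chart_symm_injective {x : M} {p : E}
    (hp : p ∈ (extChartAt 𝓘(ℝ, E) x).target) :
    Function.Injective (mfderiv 𝓘(ℝ, E) 𝓘(ℝ, E) (extChartAt 𝓘(ℝ, E) x).symm p) := by
  have : IsManifold 𝓘(ℝ, E) 1 M := IsManifold.of_le (n := ∞) (by simp)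
  have h := isInvertible_mfderivWithin_extChartAt_symm (I := 𝓘(ℝ, E)) hp
  have hr : range 𝓘(ℝ, E) = univ := by simp
  rw [hr, mfderivWithin_univ] at h
  exact h.injective

theorem mfderiv_chart_symm_self (x : M) (v : E) :
    (mfderiv 𝓘(ℝ, E) 𝓘(ℝ, E) (extChartAt 𝓘(ℝ, E) x).symm (extChartAt 𝓘(ℝ, E) x x) v : E) = v := by
  have : IsManifold 𝓘(ℝ, E) 1 M := IsManifold.of_le (n := ∞) (by simp)
  have h := mfderivWithin_range_extChartAt_symm (I := 𝓘(ℝ, E)) (x := x)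
  have hr : range 𝓘(ℝ, E) = univ := by simp
  rw [hr, mfderivWithin_univ] at h
  exact DFunLike.congr_fun h v

/-- The tangent map of the smooth inverse chart, composed with a constant field. Order 2 is what
`IsMetricNear` asks of the metric. -/
theorem contMDiffOn_mfderiv_chart_symm (x : M) (v : E) :
    ContMDiffOn 𝓘(ℝ, E) 𝓘(ℝ, E).tangent 2
      (fun p => (⟨(extChartAt 𝓘(ℝ, E) x).symm p,
        mfderiv 𝓘(ℝ, E) 𝓘(ℝ, E) (extChartAt 𝓘(ℝ, E) x).symm p v⟩ : TangentBundle 𝓘(ℝ, E) M))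
      (extChartAt 𝓘(ℝ, E) x).target := by
  have : IsManifold 𝓘(ℝ, E) 1 M := IsManifold.of_le (n := ∞) (by simp)
  have ho := isOpen_extChartAt_target (I := 𝓘(ℝ, E)) x
  have h₁ := (contMDiffOn_extChartAt_symm (I := 𝓘(ℝ, E)) (n := ∞) x).contMDiffOn_tangentMapWithin
    (m := 2) (by norm_cast) ho.uniqueMDiffOn
  have h₂ : ContMDiff 𝓘(ℝ, E) 𝓘(ℝ, E).tangent 2
      (fun p : E => (⟨p, v⟩ : TangentBundle 𝓘(ℝ, E) E)) :=
    fun p => contMDiffAt_vectorSpace_iff_contDiffAt.2 contDiffAt_const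
  refine (h₁.comp h₂.contMDiffOn (fun p hp => hp)).congr fun p hp => ?_
  simp only [Function.comp_apply, tangentMapWithin]
  rw [mfderivWithin_of_mem_nhds (ho.mem_nhds hp)]

variable [RiemannianBundle (fun x : M => TangentSpace 𝓘(ℝ, E) x)]

theorem chartMetric_self (x : M) (v w : TangentSpace 𝓘(ℝ, E) x) :
    chartMetric (E := E) x (extChartAt 𝓘(ℝ, E) x x) v w = ⟪v, w⟫_ℝ := by
  -- All tangent spaces are definitionally `E`; with arguments in `E`, the base point can be
  -- rewritten without dependent-type obstructions.
  let g : M → E → E → ℝ := fun q v w => inner ℝ (E := TangentSpace 𝓘(ℝ, E) q) v w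
  change g _ _ _ = g x v w
  rw [extChartAt_to_inv x]
  exact congrArg₂ (g x) (mfderiv_chart_symm_self (E := E) x v)
    (mfderiv_chart_symm_self (E := E) x w)

variable [FiniteDimensional ℝ E]
  [IsContMDiffRiemannianBundle 𝓘(ℝ, E) ∞ E (fun x : M => TangentSpace 𝓘(ℝ, E) x)]

theorem contDiffOn_chartMetric (x : M) :
    ContDiffOn ℝ 2 (chartMetric (E := E) x) (extChartAt 𝓘(ℝ, E) x).target := by
  refine contDiffOn_clm_apply.2 fun v => contDiffOn_clm_apply.2 fun w => ?_
  rw [← contMDiffOn_iff_contDiffOn]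
  have : IsContMDiffRiemannianBundle 𝓘(ℝ, E) 2 E (fun x : M => TangentSpace 𝓘(ℝ, E) x) :=
    IsContMDiffRiemannianBundle.of_le (n := ∞) (by norm_cast)
  exact ContMDiffOn.inner_bundle (F := E) (IB := 𝓘(ℝ, E)) (n := 2)
    (E := fun x : M => TangentSpace 𝓘(ℝ, E) x) (b := (extChartAt 𝓘(ℝ, E) x).symm)
    (contMDiffOn_mfderiv_chart_symm x v) (contMDiffOn_mfderiv_chart_symm x w)

theorem isMetricNear_chartMetric {x : M} {p : E} (hp : p ∈ (extChartAt 𝓘(ℝ, E) x).target) :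
    IsMetricNear (chartMetric (E := E) x) p where
  contDiffAt := (contDiffOn_chartMetric x).contDiffAt (chart_target_mem_nhds hp)
  symm := Filter.Eventually.of_forall fun q v w => by
    rw [chartMetric_apply, chartMetric_apply, real_inner_comm]
  isInvertible := by
    -- Positive definiteness gives injectivity, and equality of dimensions then gives invertibility.
    have hinj : Function.Injective (chartMetric (E := E) x p) := by
      refine (injective_iff_map_eq_zero _).2 fun v hv => ?_
      have h := DFunLike.congr_fun hv v
      rw [chartMetric_apply] at h
      have h' := inner_self_eq_zero.1 h
      exact (injective_iff_map_eq_zero _).1 (mfderiv_chart_symm_injective hp) v h'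
    have hdim : Module.finrank ℝ E = Module.finrank ℝ (E →L[ℝ] ℝ) := by
      rw [← (LinearMap.toContinuousLinearMap (𝕜 := ℝ) (E := E) (F' := ℝ)).finrank_eq]
      exact (Subspace.dual_finrank_eq (K := ℝ) (V := E)).symm
    exact ⟨(LinearEquiv.ofInjectiveOfFinrankEq (chartMetric (E := E) x p).toLinearMap hinj
      hdim).toContinuousLinearEquiv, by ext; rfl⟩

variable {E' : Type*} [NormedAddCommGroup E'] [NormedSpace ℝ E'] [FiniteDimensional ℝ E']
  {M' : Type*} [TopologicalSpace M'] [ChartedSpace E' M'] [IsManifold 𝓘(ℝ, E') ∞ M']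
  [RiemannianBundle (fun y : M' => TangentSpace 𝓘(ℝ, E') y)]
  [IsContMDiffRiemannianBundle 𝓘(ℝ, E') ∞ E' (fun y : M' => TangentSpace 𝓘(ℝ, E') y)]

theorem isPullbackNear_chartMetric {f : M → M'}
    (hf : IsIsometricImmersion (E := E) (E' := E') f) (x : M) :
    IsPullbackNear (chartMetric (E := E) x) (chartMetric (E := E') (f x))
      (writtenInExtChartAt 𝓘(ℝ, E) 𝓘(ℝ, E') x f) (extChartAt 𝓘(ℝ, E) x x) where
  domain := isMetricNear_chartMetric (mem_extChartAt_target x)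
  target := isMetricNear_chartMetric (by simp [writtenInExtChartAt])
  contDiffAt := (contDiffAt_writtenInExtChartAt hf.contMDiff x).of_le (by norm_cast)
  pullback := by
    set p := extChartAt 𝓘(ℝ, E) x x
    set φ := writtenInExtChartAt 𝓘(ℝ, E) 𝓘(ℝ, E') x f with hφ
    have hsrc : ∀ᶠ q in 𝓝 p, f ((extChartAt 𝓘(ℝ, E) x).symm q) ∈
        (extChartAt 𝓘(ℝ, E') (f x)).source := by
      have hc : ContinuousAt (f ∘ (extChartAt 𝓘(ℝ, E) x).symm) p :=
        hf.contMDiff.continuous.continuousAt.comp (continuousAt_extChartAt_symm x)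
      refine hc.eventually ((isOpen_extChartAt_source (f x)).mem_nhds ?_)
      simp [p]
    have hdiff : ∀ᶠ q in 𝓝 p, DifferentiableAt ℝ φ q :=
      ((((contDiffAt_writtenInExtChartAt hf.contMDiff x).of_le (m := 1)
        (by norm_cast)).eventually (by simp)).mono fun q h => h.differentiableAt (by norm_num))
    filter_upwards [hsrc.eventually_nhds, hdiff,
      chart_target_mem_nhds (mem_extChartAt_target (I := 𝓘(ℝ, E)) x)] with q hq hd ht v w
    -- The chain rule on both sides shows that Dφ in charts represents the differential of `f`; the
    -- isometry condition then becomes the pullback identity.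
    have hsymm : (extChartAt 𝓘(ℝ, E') (f x)).symm ∘ φ =ᶠ[𝓝 q]
        f ∘ (extChartAt 𝓘(ℝ, E) x).symm :=
      hq.mono fun r hr => (extChartAt 𝓘(ℝ, E') (f x)).left_inv hr
    have ht' : φ q ∈ (extChartAt 𝓘(ℝ, E') (f x)).target :=
      (extChartAt 𝓘(ℝ, E') (f x)).map_source hq.self_of_nhds
    have hm := hsymm.mfderiv_eq (I := 𝓘(ℝ, E)) (I' := 𝓘(ℝ, E'))
    rw [mfderiv_comp q (mdifferentiableAt_chart_symm ht') hd.mdifferentiableAt,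
      mfderiv_comp q ((hf.contMDiff _).mdifferentiableAt (by simp))
        (mdifferentiableAt_chart_symm ht), mfderiv_eq_fderiv] at hm
    rw [chartMetric_apply, ← hf.inner_mfderiv, chartMetric_apply]
    let g : M' → E' → E' → ℝ := fun y v w => inner ℝ (E := TangentSpace 𝓘(ℝ, E') y) v w
    have hm' := fun v : E => DFunLike.congr_fun hm v
    change g _ _ _ = g _ _ _
    have hpt : (extChartAt 𝓘(ℝ, E') (f x)).symm (φ q) = f ((extChartAt 𝓘(ℝ, E) x).symm q) :=
      hsymm.self_of_nhds
    rw [hpt]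
    exact congrArg₂ (g _) (hm' v).symm (hm' w).symm

end Charts

end SubRiemannian

namespace SubRiemannian

/-! ### Multilinearity and continuity of Christoffel symbols and curvature -/

section Tensoriality

set_option maxSynthPendingDepth 3

variable {E : Type*} [NormedAddCommGroup E] [NormedSpace ℝ E]
  {F : Type*} [NormedAddCommGroup F] [NormedSpace ℝ F]

/-- No nondegeneracy is needed: `(G p).inverse` is linear in every case. -/
theorem christoffel_add_left (G : E → E →L[ℝ] E →L[ℝ] ℝ) (p v v' w : E) :
    christoffel G p (v + v') w = christoffel G p v w + christoffel G p v' w := by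
  rw [christoffel, christoffel, christoffel, ← map_add]
  congr 1
  ext z
  simp only [christoffelFirst_apply, add_apply, map_add]
  ring

theorem christoffel_add_right (G : E → E →L[ℝ] E →L[ℝ] ℝ) (p v w w' : E) :
    christoffel G p v (w + w') = christoffel G p v w + christoffel G p v w' := by
  rw [christoffel, christoffel, christoffel, ← map_add]
  congr 1
  ext z
  simp only [christoffelFirst_apply, add_apply, map_add]
  ring

theorem christoffel_smul_left (G : E → E →L[ℝ] E →L[ℝ] ℝ) (p : E) (c : ℝ) (v w : E) :
    christoffel G p (c • v) w = c • christoffel G p v w := by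
  rw [christoffel, christoffel, ← map_smul]
  congr 1
  ext z
  simp only [christoffelFirst_apply, smul_apply, map_smul, smul_eq_mul]
  ring

theorem christoffel_smul_right (G : E → E →L[ℝ] E →L[ℝ] ℝ) (p : E) (c : ℝ) (v w : E) :
    christoffel G p v (c • w) = c • christoffel G p v w := by
  rw [christoffel, christoffel, ← map_smul]
  congr 1
  ext z
  simp only [christoffelFirst_apply, smul_apply, map_smul, smul_eq_mul]
  ring

theorem continuous_christoffel (G : E → E →L[ℝ] E →L[ℝ] ℝ) (p : E) :
    Continuous fun v : E × E => christoffel G p v.1 v.2 := by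
  have h₁ : Continuous fun v : E × E => ((fderiv ℝ G p).flip v.1).flip :=
    (ContinuousLinearMap.flipₗᵢ ℝ E E ℝ).continuous.comp (by fun_prop)
  refine (G p).inverse.continuous.comp (Continuous.const_smul (Continuous.sub ?_ ?_) (1 / 2 : ℝ))
  · fun_prop
  · exact h₁.clm_apply continuous_snd

theorem coordAmbientDeriv_add_left (G : F → F →L[ℝ] F →L[ℝ] ℝ) (φ : E → F) (p v v' w : E) :
    coordAmbientDeriv G φ p (v + v') w =
      coordAmbientDeriv G φ p v w + coordAmbientDeriv G φ p v' w := by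
  simp only [coordAmbientDeriv, map_add, add_apply, christoffel_add_left]
  abel

theorem coordAmbientDeriv_smul_left (G : F → F →L[ℝ] F →L[ℝ] ℝ) (φ : E → F) (p : E) (c : ℝ)
    (v w : E) : coordAmbientDeriv G φ p (c • v) w = c • coordAmbientDeriv G φ p v w := by
  simp only [coordAmbientDeriv, map_smul, smul_apply, christoffel_smul_left, smul_add]

theorem IsPullbackNear.coordAmbientDeriv_symm {G : E → E →L[ℝ] E →L[ℝ] ℝ}
    {G' : F → F →L[ℝ] F →L[ℝ] ℝ} {φ : E → F} {p : E} (h : IsPullbackNear G G' φ p) (v w : E) :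
    coordAmbientDeriv G' φ p v w = coordAmbientDeriv G' φ p w v := by
  rw [coordAmbientDeriv, h.fderiv_fderiv_comm, h.target.christoffel_symm, coordAmbientDeriv]

namespace IsMetricNear

variable {G : E → E →L[ℝ] E →L[ℝ] ℝ} {p : E}

/-- The curvature tensor with all indices lowered, as a bilinear form in the first and the last
argument. -/
def curvatureFormOuter [CompleteSpace E] (hG : IsMetricNear G p) (v w : E) : E →ₗ[ℝ] E →ₗ[ℝ] ℝ :=
  LinearMap.mk₂ ℝ (fun u z => G p (coordCurvature G p u v w) z)
    (fun u u' z => by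
      simp only [hG.apply_coordCurvature, hG.fderiv_christoffelFirst_apply, christoffel_add_left,
        map_add, add_apply]
      ring)
    (fun c u z => by
      simp only [hG.apply_coordCurvature, hG.fderiv_christoffelFirst_apply, christoffel_smul_left,
        map_smul, smul_apply, smul_eq_mul]
      ring)
    (fun u z z' => map_add _ _ _)
    (fun c u z => map_smul _ _ _)

/-- The curvature tensor with all indices lowered, as a bilinear form in the two middle
arguments. -/
def curvatureFormInner [CompleteSpace E] (hG : IsMetricNear G p) (u z : E) : E →ₗ[ℝ] E →ₗ[ℝ] ℝ :=
  LinearMap.mk₂ ℝ (fun v w => G p (coordCurvature G p u v w) z)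
    (fun v v' w => by
      simp only [hG.apply_coordCurvature, hG.fderiv_christoffelFirst_apply, christoffel_add_left,
        map_add, add_apply]
      ring)
    (fun c v w => by
      simp only [hG.apply_coordCurvature, hG.fderiv_christoffelFirst_apply, christoffel_smul_left,
        map_smul, smul_apply, smul_eq_mul]
      ring)
    (fun v w w' => by
      simp only [hG.apply_coordCurvature, hG.fderiv_christoffelFirst_apply, christoffel_add_right,
        map_add, add_apply]
      ring)
    (fun c v w => by
      simp only [hG.apply_coordCurvature, hG.fderiv_christoffelFirst_apply, christoffel_smul_right,
        map_smul, smul_apply, smul_eq_mul]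
      ring)

theorem continuous_sectional [CompleteSpace E] (hG : IsMetricNear G p) :
    Continuous fun v : E × E => G p (coordCurvature G p v.1 v.2 v.2) v.1 := by
  have h : ∀ a b : E × E → E, Continuous a → Continuous b →
      Continuous fun v => christoffel G p (a v) (b v) := fun a b ha hb =>
    Continuous.comp (g := fun v : E × E => christoffel G p v.1 v.2) (f := fun v => (a v, b v))
      (continuous_christoffel G p) (ha.prodMk hb)
  have h₁ := h _ _ continuous_fst continuous_fst
  have h₂ := h _ _ continuous_fst continuous_snd
  have h₃ := h _ _ continuous_snd continuous_fst
  have h₄ := h _ _ continuous_snd continuous_snd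
  simp only [hG.apply_coordCurvature, hG.fderiv_christoffelFirst_apply]
  fun_prop

end IsMetricNear

end Tensoriality

/-! ### Orthonormal families: traces and compactness -/

section Frames

variable {V : Type*} [NormedAddCommGroup V] [InnerProductSpace ℝ V]
  {W : Type*} [AddCommGroup W] [Module ℝ W] {ι κ : Type*} [Fintype ι] [Fintype κ]

theorem _root_.Orthonormal.sum_inner_smul_of_mem_span {e : ι → V} (he : Orthonormal ℝ e) {v : V}
    (hv : v ∈ Submodule.span ℝ (range e)) : ∑ i, ⟪e i, v⟫_ℝ • e i = v := by
  induction hv using Submodule.span_induction with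
  | mem v hv =>
    obtain ⟨j, rfl⟩ := hv
    classical
    simp [orthonormal_iff_ite.1 he]
  | zero => simp
  | add v w _ _ hv hw => simp only [inner_add_right, add_smul, Finset.sum_add_distrib, hv, hw]
  | smul c v _ hv => simp only [inner_smul_right, mul_smul, ← Finset.smul_sum, hv]

/-- The trace of a bilinear map over an orthonormal family depends only on the span. -/
theorem _root_.Orthonormal.sum_bilin_eq {e : ι → V} {e' : κ → V} (he : Orthonormal ℝ e)
    (he' : Orthonormal ℝ e') (h : Submodule.span ℝ (range e) = Submodule.span ℝ (range e'))
    (b : V →ₗ[ℝ] V →ₗ[ℝ] W) : ∑ i, b (e i) (e i) = ∑ j, b (e' j) (e' j) := by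
  classical
  have h₁ : ∀ i, b (e i) (e i) =
      ∑ j, ∑ k, (⟪e' j, e i⟫_ℝ * ⟪e' k, e i⟫_ℝ) • b (e' j) (e' k) := by
    intro i
    have hi := he'.sum_inner_smul_of_mem_span (h ▸ Submodule.subset_span (mem_range_self i))
    conv_lhs => rw [← hi]
    simp only [map_sum, map_smul, LinearMap.sum_apply, LinearMap.smul_apply, Finset.smul_sum,
      smul_smul]
    rw [Finset.sum_comm]
    refine Finset.sum_congr rfl fun j _ => Finset.sum_congr rfl fun k _ => ?_
    rw [mul_comm]
  -- The transition matrix between the two families is orthogonal: expand `e' k` in the family `e`.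
  have h₂ : ∀ j k, ∑ i, ⟪e' j, e i⟫_ℝ * ⟪e' k, e i⟫_ℝ = if j = k then 1 else 0 := by
    intro j k
    have hk := he.sum_inner_smul_of_mem_span (h ▸ Submodule.subset_span (mem_range_self k))
    rw [← orthonormal_iff_ite.1 he' j k]
    conv_rhs => rw [← hk]
    rw [inner_sum]
    refine Finset.sum_congr rfl fun i _ => ?_
    rw [inner_smul_right, real_inner_comm (e' k), mul_comm]
  simp only [h₁]
  rw [Finset.sum_comm]
  refine Finset.sum_congr rfl fun j _ => ?_
  rw [Finset.sum_comm]
  simp [← Finset.sum_smul, h₂]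

theorem _root_.Submodule.orthonormal_stdOrthonormalBasis [FiniteDimensional ℝ V]
    (S : Submodule ℝ V) :
    Orthonormal ℝ fun i => (stdOrthonormalBasis ℝ S i : V) :=
  (stdOrthonormalBasis ℝ S).orthonormal.comp_linearIsometry S.subtypeₗᵢ

theorem _root_.Submodule.span_stdOrthonormalBasis [FiniteDimensional ℝ V] (S : Submodule ℝ V) :
    Submodule.span ℝ (range fun i => (stdOrthonormalBasis ℝ S i : V)) = S := by
  have h := (stdOrthonormalBasis ℝ S).toBasis.span_eq
  have h' := congrArg (Submodule.map S.subtype) h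
  rw [Submodule.map_span, ← range_comp, Submodule.map_top, Submodule.range_subtype] at h'
  simpa [Function.comp_def] using h'

end Frames

end SubRiemannian

namespace SubRiemannian

section Frames

variable {V : Type*} [NormedAddCommGroup V] [InnerProductSpace ℝ V] {ι κ : Type*}

theorem _root_.Orthonormal.sumElim {e : ι → V} {e' : κ → V} (he : Orthonormal ℝ e)
    (he' : Orthonormal ℝ e') (h : ∀ i j, ⟪e i, e' j⟫_ℝ = 0) : Orthonormal ℝ (Sum.elim e e') := by
  refine ⟨fun i => ?_, fun i j hij => ?_⟩
  · rcases i with i | i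
    exacts [he.1 i, he'.1 i]
  · rcases i with i | i <;> rcases j with j | j
    · exact he.2 fun h => hij (congrArg _ h)
    · exact h i j
    · exact (real_inner_comm _ _).trans (h j i)
    · exact he'.2 fun h => hij (congrArg _ h)

/-- Orthonormality and membership in `S` are closed conditions, and unit vectors are bounded. -/
theorem isCompact_orthonormal [FiniteDimensional ℝ V] [Fintype ι] (S : Submodule ℝ V) :
    IsCompact {e : ι → V | Orthonormal ℝ e ∧ ∀ i, e i ∈ S} := by
  classical
  have : ProperSpace V := FiniteDimensional.proper_real V
  refine Metric.isCompact_of_isClosed_isBounded ?_ ?_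
  · simp only [orthonormal_iff_ite, ofPred_and, ofPred_forall]
    refine IsClosed.inter (isClosed_iInter fun i => isClosed_iInter fun j => ?_)
      (isClosed_iInter fun i => ?_)
    · exact isClosed_eq (by fun_prop) continuous_const
    · exact S.closed_of_finiteDimensional.preimage (continuous_apply i)
  · refine isBounded_iff_forall_norm_le.2 ⟨1, fun e he => ?_⟩
    exact (pi_norm_le_iff_of_nonneg zero_le_one).2 fun i => (he.1.1 i).le

end Frames

/-! ### Mutual curvature and the attained maximum -/

section Intrinsic

variable {E : Type*} [NormedAddCommGroup E] [NormedSpace ℝ E]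
  {M : Type*} [TopologicalSpace M] [ChartedSpace E M] [IsManifold 𝓘(ℝ, E) ∞ M]
  [RiemannianBundle (fun x : M => TangentSpace 𝓘(ℝ, E) x)]

theorem inner_curvature (x : M) (u v w z : TangentSpace 𝓘(ℝ, E) x) :
    ⟪curvature (E := E) x u v w, z⟫_ℝ =
      chartMetric (E := E) x (extChartAt 𝓘(ℝ, E) x x)
        (coordCurvature (chartMetric (E := E) x) (extChartAt 𝓘(ℝ, E) x x) u v w) z :=
  (chartMetric_self x _ _).symm

variable [FiniteDimensional ℝ E]
  [IsContMDiffRiemannianBundle 𝓘(ℝ, E) ∞ E (fun x : M => TangentSpace 𝓘(ℝ, E) x)]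

theorem isMetricNear_chartMetric_self (x : M) :
    IsMetricNear (chartMetric (E := E) x) (extChartAt 𝓘(ℝ, E) x x) :=
  isMetricNear_chartMetric (mem_extChartAt_target x)

/-- `⟪R_{u,v} v, z⟫` as a bilinear form in `u` and `z`. -/
def curvatureFormOuter (x : M) (v : TangentSpace 𝓘(ℝ, E) x) :
    TangentSpace 𝓘(ℝ, E) x →ₗ[ℝ] TangentSpace 𝓘(ℝ, E) x →ₗ[ℝ] ℝ :=
  (isMetricNear_chartMetric_self (E := E) x).curvatureFormOuter v v

/-- `⟪R_{u,v} w, u⟫` as a bilinear form in `v` and `w`. -/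
def curvatureFormInner (x : M) (u : TangentSpace 𝓘(ℝ, E) x) :
    TangentSpace 𝓘(ℝ, E) x →ₗ[ℝ] TangentSpace 𝓘(ℝ, E) x →ₗ[ℝ] ℝ :=
  (isMetricNear_chartMetric_self (E := E) x).curvatureFormInner u u

theorem curvatureFormOuter_self (x : M) (u v : TangentSpace 𝓘(ℝ, E) x) :
    curvatureFormOuter x v u u = sectionalCurvature (E := E) x u v :=
  (inner_curvature x u v v u).symm

theorem curvatureFormInner_self (x : M) (u v : TangentSpace 𝓘(ℝ, E) x) :
    curvatureFormInner x u v v = sectionalCurvature (E := E) x u v :=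
  (inner_curvature x u v v u).symm

theorem continuous_sectionalCurvature (x : M) :
    Continuous fun v : TangentSpace 𝓘(ℝ, E) x × TangentSpace 𝓘(ℝ, E) x =>
      sectionalCurvature (E := E) x v.1 v.2 := by
  simp only [sectionalCurvature, inner_curvature]
  exact (isMetricNear_chartMetric_self (E := E) x).continuous_sectional

/-- The mutual curvature can be computed with any orthonormal bases. -/
theorem mutualCurvature_eq_sum {ι κ : Type*} [Fintype ι] [Fintype κ] (x : M)
    {V W : Submodule ℝ (TangentSpace 𝓘(ℝ, E) x)}
    {e : ι → TangentSpace 𝓘(ℝ, E) x} {e' : κ → TangentSpace 𝓘(ℝ, E) x}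
    (he : Orthonormal ℝ e) (he' : Orthonormal ℝ e') (hV : Submodule.span ℝ (range e) = V)
    (hW : Submodule.span ℝ (range e') = W) :
    mutualCurvature x V W = ∑ a, ∑ b, sectionalCurvature (E := E) x (e a) (e' b) := by
  rw [mutualCurvature]
  simp only [← curvatureFormInner_self]
  -- The bases are exchanged one at a time: first that of `W`, with the vector of `V` fixed, then
  -- that of `V` after swapping the sums.
  have h₁ : ∀ u, ∑ b, curvatureFormInner x u (stdOrthonormalBasis ℝ W b : TangentSpace 𝓘(ℝ, E) x)
      (stdOrthonormalBasis ℝ W b : TangentSpace 𝓘(ℝ, E) x) =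
      ∑ b, curvatureFormInner x u (e' b) (e' b) := fun u =>
    W.orthonormal_stdOrthonormalBasis.sum_bilin_eq he'
      (W.span_stdOrthonormalBasis.trans hW.symm) _
  simp only [h₁]
  rw [Finset.sum_comm, Finset.sum_comm (s := Finset.univ (α := ι))]
  refine Finset.sum_congr rfl fun b _ => ?_
  simp only [curvatureFormInner_self, ← curvatureFormOuter_self]
  exact V.orthonormal_stdOrthonormalBasis.sum_bilin_eq he
    (V.span_stdOrthonormalBasis.trans hV.symm) _

/-- A pair of orthogonal subspaces corresponds to the two halves of one orthonormal family, so the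
values form the continuous image of a compact set. -/
theorem mutualCurvatureValues_eq_image {d : ℕ} (D : Distribution E M d) (n₁ n₂ : ℕ) (x : M) :
    mutualCurvatureValues D n₁ n₂ x =
      (fun e : Fin n₁ ⊕ Fin n₂ → TangentSpace 𝓘(ℝ, E) x =>
        ∑ a, ∑ b, sectionalCurvature (E := E) x (e (Sum.inl a)) (e (Sum.inr b))) ''
      {e | Orthonormal ℝ e ∧ ∀ i, e i ∈ D.fiber x} := by
  ext s
  constructor
  -- Substituting the dimensions for `n₁` and `n₂` makes the standard bases indexed by `Fin n₁` and
  -- `Fin n₂`.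
  · rintro ⟨V, W, hV, hW, hVW, rfl, rfl, rfl⟩
    refine ⟨Sum.elim (fun i => (stdOrthonormalBasis ℝ V i : TangentSpace 𝓘(ℝ, E) x))
      (fun i => (stdOrthonormalBasis ℝ W i : TangentSpace 𝓘(ℝ, E) x)), ⟨?_, ?_⟩, rfl⟩
    · exact V.orthonormal_stdOrthonormalBasis.sumElim W.orthonormal_stdOrthonormalBasis
        fun i j => Submodule.isOrtho_iff_inner_eq.1 hVW _ (Subtype.coe_prop _) _
          (Subtype.coe_prop _)
    · rintro (i | i)
      exacts [hV (Subtype.coe_prop _), hW (Subtype.coe_prop _)]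
  · rintro ⟨e, ⟨he, heD⟩, rfl⟩
    have h₁ := he.comp _ Sum.inl_injective
    have h₂ := he.comp _ Sum.inr_injective
    refine ⟨Submodule.span ℝ (range (e ∘ Sum.inl)), Submodule.span ℝ (range (e ∘ Sum.inr)),
      Submodule.span_le.2 ?_, Submodule.span_le.2 ?_, Submodule.isOrtho_span.2 ?_,
      ?_, ?_, (mutualCurvature_eq_sum x h₁ h₂ rfl rfl).symm⟩
    · rintro _ ⟨i, rfl⟩
      exact heD _
    · rintro _ ⟨i, rfl⟩
      exact heD _
    · rintro _ ⟨i, rfl⟩ _ ⟨j, rfl⟩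
      exact he.2 Sum.inl_ne_inr
    · rw [finrank_span_eq_card h₁.linearIndependent, Fintype.card_fin]
    · rw [finrank_span_eq_card h₂.linearIndependent, Fintype.card_fin]

/-- The maximum in the definition of `δ⁺` is attained as soon as there is some competitor. -/
theorem isGreatest_deltaPlus {d : ℕ} (D : Distribution E M d) {n₁ n₂ : ℕ} {x : M}
    (h : (mutualCurvatureValues D n₁ n₂ x).Nonempty) :
    IsGreatest (mutualCurvatureValues D n₁ n₂ x) (deltaPlus D n₁ n₂ x) := by
  have hc : IsCompact (mutualCurvatureValues D n₁ n₂ x) := by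
    rw [mutualCurvatureValues_eq_image]
    refine (isCompact_orthonormal (D.fiber x)).image ?_
    refine continuous_finsetSum _ fun a _ => continuous_finsetSum _ fun b _ => ?_
    exact Continuous.comp (f := fun e : Fin n₁ ⊕ Fin n₂ → TangentSpace 𝓘(ℝ, E) x =>
      (e (Sum.inl a), e (Sum.inr b))) (continuous_sectionalCurvature x) (by fun_prop)
  exact hc.isGreatest_sSup h

end Intrinsic

section Map

variable {E : Type*} [NormedAddCommGroup E] [NormedSpace ℝ E]
  {M : Type*} [TopologicalSpace M] [ChartedSpace E M]
  {E' : Type*} [NormedAddCommGroup E'] [NormedSpace ℝ E']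
  {M' : Type*} [TopologicalSpace M'] [ChartedSpace E' M']
  [RiemannianBundle (fun y : M' => TangentSpace 𝓘(ℝ, E') y)] {f : M → M'}

theorem inner_mfderiv_secondFundamentalForm [FiniteDimensional ℝ E] (x : M)
    (v w z : TangentSpace 𝓘(ℝ, E) x) :
    ⟪mfderiv 𝓘(ℝ, E) 𝓘(ℝ, E') f x z, secondFundamentalForm (E' := E') f x v w⟫_ℝ = 0 :=
  (Submodule.mem_orthogonal _ _).1 (Submodule.starProjection_apply_mem _ _) _ ⟨z, rfl⟩

theorem chartMetric_writtenInExtChartAt [IsManifold 𝓘(ℝ, E') ∞ M'] (x : M)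
    (v w : TangentSpace 𝓘(ℝ, E') (f x)) :
    chartMetric (E := E') (f x)
      (writtenInExtChartAt 𝓘(ℝ, E) 𝓘(ℝ, E') x f (extChartAt 𝓘(ℝ, E) x x)) v w = ⟪v, w⟫_ℝ := by
  have h : writtenInExtChartAt 𝓘(ℝ, E) 𝓘(ℝ, E') x f (extChartAt 𝓘(ℝ, E) x x) =
    extChartAt 𝓘(ℝ, E') (f x) (f x) := by simp [writtenInExtChartAt]
  exact (congrArg (fun p => chartMetric (E := E') (f x) p v w) h).trans (chartMetric_self _ v w)

end Map

/-! ### Gauss formula and Gauss equation on manifolds -/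

section Extrinsic

variable {E : Type*} [NormedAddCommGroup E] [NormedSpace ℝ E] [FiniteDimensional ℝ E]
  {M : Type*} [TopologicalSpace M] [ChartedSpace E M] [IsManifold 𝓘(ℝ, E) ∞ M]
  [RiemannianBundle (fun x : M => TangentSpace 𝓘(ℝ, E) x)]
  [IsContMDiffRiemannianBundle 𝓘(ℝ, E) ∞ E (fun x : M => TangentSpace 𝓘(ℝ, E) x)]
  {E' : Type*} [NormedAddCommGroup E'] [NormedSpace ℝ E'] [FiniteDimensional ℝ E']
  {M' : Type*} [TopologicalSpace M'] [ChartedSpace E' M'] [IsManifold 𝓘(ℝ, E') ∞ M']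
  [RiemannianBundle (fun y : M' => TangentSpace 𝓘(ℝ, E') y)]
  [IsContMDiffRiemannianBundle 𝓘(ℝ, E') ∞ E' (fun y : M' => TangentSpace 𝓘(ℝ, E') y)]
  {f : M → M'}

/-- The Levi-Civita derivative at `x` of the extension of `w` which is constant in the chart. -/
def chartDeriv (x : M) (v w : TangentSpace 𝓘(ℝ, E) x) : TangentSpace 𝓘(ℝ, E) x :=
  christoffel (chartMetric (E := E) x) (extChartAt 𝓘(ℝ, E) x x) v w

/-- Differentiating q ↦ Dφ_q(w) agrees with evaluating D²φ because Dφ is differentiable. -/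
theorem ambientDeriv_eq (hf : IsIsometricImmersion (E := E) (E' := E') f) (x : M)
    (v w : TangentSpace 𝓘(ℝ, E) x) :
    ambientDeriv (E' := E') f x v w =
      coordAmbientDeriv (chartMetric (E := E') (f x)) (writtenInExtChartAt 𝓘(ℝ, E) 𝓘(ℝ, E') x f)
        (extChartAt 𝓘(ℝ, E) x x) v w := by
  have h := IsPullbackNear.fderiv_apply (isPullbackNear_chartMetric hf x).differentiableAt_fderiv
    (w : E) (v : E)
  exact congrArg (· + christoffel (chartMetric (E := E') (f x))
    (writtenInExtChartAt 𝓘(ℝ, E) 𝓘(ℝ, E') x f (extChartAt 𝓘(ℝ, E) x x)) _ _) h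

theorem inner_ambientDeriv (hf : IsIsometricImmersion (E := E) (E' := E') f) (x : M)
    (v w z : TangentSpace 𝓘(ℝ, E) x) :
    ⟪ambientDeriv (E' := E') f x v w, mfderiv 𝓘(ℝ, E) 𝓘(ℝ, E') f x z⟫_ℝ =
      ⟪chartDeriv x v w, z⟫_ℝ := by
  have h := (isPullbackNear_chartMetric hf x).apply_coordAmbientDeriv v w z
  rw [← chartMetric_writtenInExtChartAt (E := E) x, ambientDeriv_eq hf]
  refine Eq.trans ?_ (h.trans (chartMetric_self x (chartDeriv x v w) z))
  exact congrArg _ (fderiv_writtenInExtChartAt hf.contMDiff x z).symm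

/-- The Gauss formula. -/
theorem ambientDeriv_eq_add (hf : IsIsometricImmersion (E := E) (E' := E') f) (x : M)
    (v w : TangentSpace 𝓘(ℝ, E) x) :
    ambientDeriv (E' := E') f x v w =
      mfderiv 𝓘(ℝ, E) 𝓘(ℝ, E') f x (chartDeriv x v w)
        + secondFundamentalForm (E' := E') f x v w := by
  set A := mfderiv 𝓘(ℝ, E) 𝓘(ℝ, E') f x
  -- Subtracting the intrinsic derivative leaves a normal vector, and this decomposition
  -- characterises the orthogonal projection.
  have h₁ : ambientDeriv (E' := E') f x v w - A (chartDeriv x v w) ∈ A.rangeᗮ := by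
    rw [Submodule.mem_orthogonal']
    rintro _ ⟨z, rfl⟩
    have h := inner_ambientDeriv hf x v w z
    rw [inner_sub_left]
    exact sub_eq_zero.2 (h.trans (hf.inner_mfderiv x _ _).symm)
  have h₂ : A (chartDeriv x v w) ∈ A.rangeᗮᗮ :=
    Submodule.le_orthogonal_orthogonal _ ⟨_, rfl⟩
  have h₃ : secondFundamentalForm (E' := E') f x v w =
      ambientDeriv (E' := E') f x v w - A (chartDeriv x v w) := by
    refine Submodule.eq_starProjection_of_mem_orthogonal ?_ ?_
    · exact h₁
    · rw [sub_sub_cancel]; exact h₂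
  rw [h₃]
  abel

/-- The Gauss equation. -/
theorem gauss_equation (hf : IsIsometricImmersion (E := E) (E' := E') f) (x : M)
    (u v w z : TangentSpace 𝓘(ℝ, E) x) :
    ⟪curvature (E := E) x u v w, z⟫_ℝ =
      ⟪curvature (E := E') (f x) (mfderiv 𝓘(ℝ, E) 𝓘(ℝ, E') f x u)
          (mfderiv 𝓘(ℝ, E) 𝓘(ℝ, E') f x v) (mfderiv 𝓘(ℝ, E) 𝓘(ℝ, E') f x w),
        mfderiv 𝓘(ℝ, E) 𝓘(ℝ, E') f x z⟫_ℝ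
      + ⟪secondFundamentalForm (E' := E') f x v w, secondFundamentalForm (E' := E') f x u z⟫_ℝ
      - ⟪secondFundamentalForm (E' := E') f x u w, secondFundamentalForm (E' := E') f x v z⟫_ℝ := by
  -- By Pythagoras, removing the tangential product from the product of ambient derivatives leaves
  -- the product of the normal parts.
  have hB : ∀ a b c d : TangentSpace 𝓘(ℝ, E) x,
      chartMetric (E := E') (f x)
        (writtenInExtChartAt 𝓘(ℝ, E) 𝓘(ℝ, E') x f (extChartAt 𝓘(ℝ, E) x x))
        (coordAmbientDeriv (chartMetric (E := E') (f x))
          (writtenInExtChartAt 𝓘(ℝ, E) 𝓘(ℝ, E') x f) (extChartAt 𝓘(ℝ, E) x x) a b)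
        (coordAmbientDeriv (chartMetric (E := E') (f x))
          (writtenInExtChartAt 𝓘(ℝ, E) 𝓘(ℝ, E') x f) (extChartAt 𝓘(ℝ, E) x x) c d)
      - chartMetric (E := E) x (extChartAt 𝓘(ℝ, E) x x)
          (christoffel (chartMetric (E := E) x) (extChartAt 𝓘(ℝ, E) x x) a b)
          (christoffel (chartMetric (E := E) x) (extChartAt 𝓘(ℝ, E) x x) c d)
      = ⟪secondFundamentalForm (E' := E') f x a b,
          secondFundamentalForm (E' := E') f x c d⟫_ℝ := by
    intro a b c d
    have h₁ : ⟪ambientDeriv (E' := E') f x a b, ambientDeriv (E' := E') f x c d⟫_ℝ =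
        ⟪chartDeriv x a b, chartDeriv x c d⟫_ℝ +
          ⟪secondFundamentalForm (E' := E') f x a b,
            secondFundamentalForm (E' := E') f x c d⟫_ℝ := by
      rw [ambientDeriv_eq_add hf, ambientDeriv_eq_add hf, inner_add_left, inner_add_right,
        inner_add_right, hf.inner_mfderiv, inner_mfderiv_secondFundamentalForm,
        real_inner_comm (mfderiv 𝓘(ℝ, E) 𝓘(ℝ, E') f x (chartDeriv x c d)),
        inner_mfderiv_secondFundamentalForm]
      ring
    rw [← chartMetric_writtenInExtChartAt (E := E) x, ← chartMetric_self x, ambientDeriv_eq hf,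
      ambientDeriv_eq hf] at h₁
    exact sub_eq_iff_eq_add'.2 h₁
  have h := (isPullbackNear_chartMetric hf x).gauss_aux u v w z
  rw [hB v w u z, hB u w v z] at h
  rw [inner_curvature, h]
  congr 2
  have hp : writtenInExtChartAt 𝓘(ℝ, E) 𝓘(ℝ, E') x f (extChartAt 𝓘(ℝ, E) x x) =
    extChartAt 𝓘(ℝ, E') (f x) (f x) := by simp [writtenInExtChartAt]
  rw [inner_curvature, hp]
  have hd := fderiv_writtenInExtChartAt hf.contMDiff x
  -- With all arguments in `E'`, the derivative in charts is replaced by the differential of `f` in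
  -- one slot after another.
  let R : E' → E' → E' → E' → ℝ := fun a b c d =>
    chartMetric (E := E') (f x) (extChartAt 𝓘(ℝ, E') (f x) (f x))
      (coordCurvature (chartMetric (E := E') (f x)) (extChartAt 𝓘(ℝ, E') (f x) (f x)) a b c) d
  have hR := congr (congr (congr (congrArg R (hd u)) (hd v)) (hd w)) (hd z)
  exact hR

end Extrinsic

end SubRiemannian

namespace SubRiemannian

/-! ### Traces of the second fundamental form and the summed Gauss equation -/

section SecondFundamentalForm

variable {E : Type*} [NormedAddCommGroup E] [NormedSpace ℝ E] [FiniteDimensional ℝ E]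
  {M : Type*} [TopologicalSpace M] [ChartedSpace E M] [IsManifold 𝓘(ℝ, E) ∞ M]
  [RiemannianBundle (fun x : M => TangentSpace 𝓘(ℝ, E) x)]
  [IsContMDiffRiemannianBundle 𝓘(ℝ, E) ∞ E (fun x : M => TangentSpace 𝓘(ℝ, E) x)]
  {E' : Type*} [NormedAddCommGroup E'] [NormedSpace ℝ E'] [FiniteDimensional ℝ E']
  {M' : Type*} [TopologicalSpace M'] [ChartedSpace E' M'] [IsManifold 𝓘(ℝ, E') ∞ M']
  [RiemannianBundle (fun y : M' => TangentSpace 𝓘(ℝ, E') y)]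
  [IsContMDiffRiemannianBundle 𝓘(ℝ, E') ∞ E' (fun y : M' => TangentSpace 𝓘(ℝ, E') y)]
  {f : M → M'}

/-- The ambient derivative is already symmetric: D²φ is, and the Levi-Civita connection has no
torsion. -/
theorem secondFundamentalForm_symm (hf : IsIsometricImmersion (E := E) (E' := E') f) (x : M)
    (v w : TangentSpace 𝓘(ℝ, E) x) :
    secondFundamentalForm (E' := E') f x v w = secondFundamentalForm (E' := E') f x w v := by
  have h : ambientDeriv (E' := E') f x v w = ambientDeriv (E' := E') f x w v :=
    (ambientDeriv_eq hf x v w).trans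
      (((isPullbackNear_chartMetric hf x).coordAmbientDeriv_symm v w).trans
        (ambientDeriv_eq hf x w v).symm)
  rw [secondFundamentalForm, h, secondFundamentalForm]

theorem secondFundamentalForm_add_left (hf : IsIsometricImmersion (E := E) (E' := E') f) (x : M)
    (v v' w : TangentSpace 𝓘(ℝ, E) x) :
    secondFundamentalForm (E' := E') f x (v + v') w =
      secondFundamentalForm (E' := E') f x v w + secondFundamentalForm (E' := E') f x v' w := by
  have h : ambientDeriv (E' := E') f x (v + v') w =
      ambientDeriv (E' := E') f x v w + ambientDeriv (E' := E') f x v' w := by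
    rw [ambientDeriv_eq hf, ambientDeriv_eq hf, ambientDeriv_eq hf]
    exact coordAmbientDeriv_add_left (E := E) (F := E') _ _ _ _ _ _
  rw [secondFundamentalForm, h, map_add, secondFundamentalForm, secondFundamentalForm]

theorem secondFundamentalForm_smul_left (hf : IsIsometricImmersion (E := E) (E' := E') f) (x : M)
    (c : ℝ) (v w : TangentSpace 𝓘(ℝ, E) x) :
    secondFundamentalForm (E' := E') f x (c • v) w =
      c • secondFundamentalForm (E' := E') f x v w := by
  have h : ambientDeriv (E' := E') f x (c • v) w = c • ambientDeriv (E' := E') f x v w := by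
    rw [ambientDeriv_eq hf, ambientDeriv_eq hf]
    exact coordAmbientDeriv_smul_left (E := E) (F := E') _ _ _ _ _ _
  rw [secondFundamentalForm, h, map_smul, secondFundamentalForm]

/-- The second fundamental form as a bilinear map. -/
def secondFundamentalFormBilin (hf : IsIsometricImmersion (E := E) (E' := E') f) (x : M) :
    TangentSpace 𝓘(ℝ, E) x →ₗ[ℝ] TangentSpace 𝓘(ℝ, E) x →ₗ[ℝ] TangentSpace 𝓘(ℝ, E') (f x) :=
  LinearMap.mk₂ ℝ (secondFundamentalForm (E' := E') f x)
    (secondFundamentalForm_add_left hf x) (secondFundamentalForm_smul_left hf x)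
    (fun v w w' => by
      rw [secondFundamentalForm_symm hf, secondFundamentalForm_add_left hf,
        secondFundamentalForm_symm hf x w, secondFundamentalForm_symm hf x w'])
    (fun c v w => by
      rw [secondFundamentalForm_symm hf, secondFundamentalForm_smul_left hf,
        secondFundamentalForm_symm hf x w])

/-- The mean curvature can be computed with any orthonormal basis. -/
theorem meanCurvature_eq_sum {ι : Type*} [Fintype ι]
    (hf : IsIsometricImmersion (E := E) (E' := E') f) (x : M)
    {V : Submodule ℝ (TangentSpace 𝓘(ℝ, E) x)} {e : ι → TangentSpace 𝓘(ℝ, E) x}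
    (he : Orthonormal ℝ e) (hV : Submodule.span ℝ (range e) = V) :
    meanCurvature (E' := E') f x V = ∑ i, secondFundamentalForm (E' := E') f x (e i) (e i) :=
  V.orthonormal_stdOrthonormalBasis.sum_bilin_eq he (V.span_stdOrthonormalBasis.trans hV.symm)
    (secondFundamentalFormBilin hf x)

/-- Orthonormal bases of orthogonal subspaces together form an orthonormal basis of their sum. -/
theorem meanCurvature_sup (hf : IsIsometricImmersion (E := E) (E' := E') f) (x : M)
    {V W : Submodule ℝ (TangentSpace 𝓘(ℝ, E) x)} (h : V ⟂ W) :
    meanCurvature (E' := E') f x (V ⊔ W) =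
      meanCurvature (E' := E') f x V + meanCurvature (E' := E') f x W := by
  have he := V.orthonormal_stdOrthonormalBasis.sumElim W.orthonormal_stdOrthonormalBasis
    fun i j => Submodule.isOrtho_iff_inner_eq.1 h _ (Subtype.coe_prop _) _ (Subtype.coe_prop _)
  rw [meanCurvature_eq_sum hf x he (by
    rw [Sum.elim_range, Submodule.span_union, V.span_stdOrthonormalBasis,
      W.span_stdOrthonormalBasis])]
  simp [meanCurvature]

/-- By bilinearity spanning families suffice; this matches the sum of squares in the summed Gauss
equation. -/
theorem isMixedTotallyGeodesic_iff {ι κ : Type*}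
    (hf : IsIsometricImmersion (E := E) (E' := E') f) (x : M)
    {V W : Submodule ℝ (TangentSpace 𝓘(ℝ, E) x)}
    {e : ι → TangentSpace 𝓘(ℝ, E) x} {e' : κ → TangentSpace 𝓘(ℝ, E) x}
    (hV : Submodule.span ℝ (range e) = V) (hW : Submodule.span ℝ (range e') = W) :
    IsMixedTotallyGeodesic (E' := E') f x V W ↔
      ∀ a b, secondFundamentalForm (E' := E') f x (e a) (e' b) = 0 := by
  subst hV hW
  refine ⟨fun h a b => h _ (Submodule.subset_span (mem_range_self a)) _
    (Submodule.subset_span (mem_range_self b)), fun h v hv w hw => ?_⟩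
  have h₁ : ∀ b, Submodule.span ℝ (range e) ≤
      ((secondFundamentalFormBilin hf x).flip (e' b)).ker := fun b =>
    Submodule.span_le.2 (by rintro _ ⟨a, rfl⟩; exact h a b)
  have h₂ : Submodule.span ℝ (range e') ≤ (secondFundamentalFormBilin hf x v).ker :=
    Submodule.span_le.2 (by rintro _ ⟨b, rfl⟩; exact h₁ b hv)
  exact h₂ hw

/-- The differential of an isometric immersion as a linear isometry. -/
def IsIsometricImmersion.toLinearIsometry (hf : IsIsometricImmersion (E := E) (E' := E') f)
    (x : M) : TangentSpace 𝓘(ℝ, E) x →ₗᵢ[ℝ] TangentSpace 𝓘(ℝ, E') (f x) :=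
  (mfderiv 𝓘(ℝ, E) 𝓘(ℝ, E') f x).toLinearMap.isometryOfInner (hf.inner_mfderiv x)

/-- The Gauss equation, summed over orthonormal bases of two subspaces. -/
theorem mutualCurvature_eq (hf : IsIsometricImmersion (E := E) (E' := E') f) (x : M)
    (V W : Submodule ℝ (TangentSpace 𝓘(ℝ, E) x)) :
    mutualCurvature x V W =
      mutualCurvature (E := E') (f x) (V.map (mfderiv 𝓘(ℝ, E) 𝓘(ℝ, E') f x).toLinearMap)
          (W.map (mfderiv 𝓘(ℝ, E) 𝓘(ℝ, E') f x).toLinearMap)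
        + ⟪meanCurvature (E' := E') f x V, meanCurvature (E' := E') f x W⟫_ℝ
        - ∑ a, ∑ b, ‖secondFundamentalForm (E' := E') f x
            (stdOrthonormalBasis ℝ V a : TangentSpace 𝓘(ℝ, E) x)
            (stdOrthonormalBasis ℝ W b : TangentSpace 𝓘(ℝ, E) x)‖ ^ 2 := by
  have hmap : ∀ U : Submodule ℝ (TangentSpace 𝓘(ℝ, E) x), Submodule.span ℝ (range
      (hf.toLinearIsometry x ∘ fun i => (stdOrthonormalBasis ℝ U i : TangentSpace 𝓘(ℝ, E) x))) =
      U.map (mfderiv 𝓘(ℝ, E) 𝓘(ℝ, E') f x).toLinearMap := fun U => by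
    conv_rhs => rw [← U.span_stdOrthonormalBasis, Submodule.map_span, ← range_comp]
    rfl
  rw [mutualCurvature_eq_sum (f x)
    (V.orthonormal_stdOrthonormalBasis.comp_linearIsometry (hf.toLinearIsometry x))
    (W.orthonormal_stdOrthonormalBasis.comp_linearIsometry (hf.toLinearIsometry x))
    (hmap V) (hmap W), mutualCurvature, meanCurvature, meanCurvature, sum_inner]
  simp only [inner_sum, ← Finset.sum_add_distrib, ← Finset.sum_sub_distrib]
  refine Finset.sum_congr rfl fun a _ => Finset.sum_congr rfl fun b _ => ?_
  -- For u = e_a and v = e'_b, symmetry of h̄ makes the last Gauss term ‖h̄(e_a, e'_b)‖².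
  rw [sectionalCurvature, gauss_equation hf, secondFundamentalForm_symm hf x
    (stdOrthonormalBasis ℝ W b : TangentSpace 𝓘(ℝ, E) x)
    (stdOrthonormalBasis ℝ V a : TangentSpace 𝓘(ℝ, E) x), real_inner_self_eq_norm_sq,
    real_inner_comm (secondFundamentalForm (E' := E') f x
      (stdOrthonormalBasis ℝ V a : TangentSpace 𝓘(ℝ, E) x)
      (stdOrthonormalBasis ℝ V a : TangentSpace 𝓘(ℝ, E) x))]
  rfl

end SecondFundamentalForm

end SubRiemannian

end

/-! ### The inequality and its equality case -/

theorem theorem2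
    {E : Type*} [NormedAddCommGroup E] [NormedSpace ℝ E] [FiniteDimensional ℝ E]
    {M : Type*} [TopologicalSpace M] [ChartedSpace E M] [IsManifold 𝓘(ℝ, E) ∞ M]
    [RiemannianBundle (fun x : M => TangentSpace 𝓘(ℝ, E) x)]
    [IsContMDiffRiemannianBundle 𝓘(ℝ, E) ∞ E (fun x : M => TangentSpace 𝓘(ℝ, E) x)]
    {E' : Type*} [NormedAddCommGroup E'] [NormedSpace ℝ E'] [FiniteDimensional ℝ E']
    {M' : Type*} [TopologicalSpace M'] [ChartedSpace E' M'] [IsManifold 𝓘(ℝ, E') ∞ M']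
    [RiemannianBundle (fun y : M' => TangentSpace 𝓘(ℝ, E') y)]
    [IsContMDiffRiemannianBundle 𝓘(ℝ, E') ∞ E' (fun y : M' => TangentSpace 𝓘(ℝ, E') y)]
    {d d' n₁ n₂ : ℕ} (hn₁ : 0 < n₁) (hn₂ : 0 < n₂)
    (D : SubRiemannian.Distribution E M d)
    (D₁ : SubRiemannian.Distribution E M n₁) (D₂ : SubRiemannian.Distribution E M n₂)
    (hsum : ∀ x, D.fiber x = D₁.fiber x ⊔ D₂.fiber x)
    (horth : ∀ x, D₁.fiber x ⟂ D₂.fiber x)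
    (D' : SubRiemannian.Distribution E' M' d')
    (f : M → M') (hf : SubRiemannian.IsIsometricImmersion (E := E) (E' := E') f)
    (hD : SubRiemannian.IsAdapted f D D') (x : M) :
    IsGreatest (SubRiemannian.mutualCurvatureValues D' n₁ n₂ (f x))
        (SubRiemannian.deltaPlus D' n₁ n₂ (f x)) ∧
      SubRiemannian.mutualCurvature x (D₁.fiber x) (D₂.fiber x) ≤
        1 / 4 * ‖SubRiemannian.meanCurvature (E' := E') f x (D.fiber x)‖ ^ 2
          + SubRiemannian.deltaPlus D' n₁ n₂ (f x) ∧
      (SubRiemannian.mutualCurvature x (D₁.fiber x) (D₂.fiber x) =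
          1 / 4 * ‖SubRiemannian.meanCurvature (E' := E') f x (D.fiber x)‖ ^ 2
            + SubRiemannian.deltaPlus D' n₁ n₂ (f x) ↔
        SubRiemannian.IsMixedTotallyGeodesic (E' := E') f x (D₁.fiber x) (D₂.fiber x) ∧
        SubRiemannian.meanCurvature (E' := E') f x (D₁.fiber x) =
          SubRiemannian.meanCurvature (E' := E') f x (D₂.fiber x) ∧
        SubRiemannian.mutualCurvature (E := E') (f x)
            ((D₁.fiber x).map (mfderiv 𝓘(ℝ, E) 𝓘(ℝ, E') f x).toLinearMap)
            ((D₂.fiber x).map (mfderiv 𝓘(ℝ, E) 𝓘(ℝ, E') f x).toLinearMap) =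
          SubRiemannian.deltaPlus D' n₁ n₂ (f x)) := by
  -- The image pair lies in 𝒟̄ by adaptedness and keeps dimensions and orthogonality by isometry. It
  -- also shows that the set of competitors is nonempty.
  have hmem : SubRiemannian.mutualCurvature (E := E') (f x)
      ((D₁.fiber x).map (mfderiv 𝓘(ℝ, E) 𝓘(ℝ, E') f x).toLinearMap)
      ((D₂.fiber x).map (mfderiv 𝓘(ℝ, E) 𝓘(ℝ, E') f x).toLinearMap) ∈
        SubRiemannian.mutualCurvatureValues D' n₁ n₂ (f x) := by
    have hle : ∀ V, V ≤ D.fiber x →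
        V.map (mfderiv 𝓘(ℝ, E) 𝓘(ℝ, E') f x).toLinearMap ≤ D'.fiber (f x) := fun V hV =>
      Submodule.map_le_iff_le_comap.2 fun v hv => hD x v (hV hv)
    have hinj : Function.Injective (mfderiv 𝓘(ℝ, E) 𝓘(ℝ, E') f x).toLinearMap :=
      (hf.toLinearIsometry x).injective
    refine ⟨_, _, hle _ (hsum x ▸ le_sup_left), hle _ (hsum x ▸ le_sup_right),
      Submodule.isOrtho_iff_inner_eq.2 ?_, ?_, ?_, rfl⟩
    · rintro _ ⟨v, hv, rfl⟩ _ ⟨w, hw, rfl⟩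
      exact (hf.inner_mfderiv x v w).trans
        (Submodule.isOrtho_iff_inner_eq.1 (horth x) v hv w hw)
    · exact (LinearEquiv.finrank_eq (Submodule.equivMapOfInjective _ hinj _)).symm.trans
        (D₁.finrank_fiber x)
    · exact (LinearEquiv.finrank_eq (Submodule.equivMapOfInjective _ hinj _)).symm.trans
        (D₂.finrank_fiber x)
  have hgreat := SubRiemannian.isGreatest_deltaPlus D' ⟨_, hmem⟩
  have hle := hgreat.2 hmem
  rw [SubRiemannian.isMixedTotallyGeodesic_iff hf x (D₁.fiber x).span_stdOrthonormalBasis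
    (D₂.fiber x).span_stdOrthonormalBasis, SubRiemannian.mutualCurvature_eq hf, hsum,
    SubRiemannian.meanCurvature_sup hf x (horth x)]
  set H₁ := SubRiemannian.meanCurvature (E' := E') f x (D₁.fiber x)
  set H₂ := SubRiemannian.meanCurvature (E' := E') f x (D₂.fiber x)
  -- Together these two expansions give the polarisation 4⟨H̄₁, H̄₂⟩ = ‖H̄₁ + H̄₂‖² − ‖H̄₁ − H̄₂‖².
  have hadd := norm_add_sq_real H₁ H₂
  have hsub := norm_sub_sq_real H₁ H₂
  have hN := sq_nonneg ‖H₁ - H₂‖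
  have hQ₀ : ∀ a, 0 ≤ ∑ b, ‖SubRiemannian.secondFundamentalForm (E' := E') f x
      (stdOrthonormalBasis ℝ (D₁.fiber x) a : TangentSpace 𝓘(ℝ, E) x)
      (stdOrthonormalBasis ℝ (D₂.fiber x) b : TangentSpace 𝓘(ℝ, E) x)‖ ^ 2 :=
    fun a => Finset.sum_nonneg fun b _ => sq_nonneg _
  have hQ := Finset.sum_nonneg fun a (_ : a ∈ Finset.univ) => hQ₀ a
  -- The defect is the sum of three nonnegative terms controlled by `hN`, `hQ` and `hle`; under
  -- equality each is squeezed to zero.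
  refine ⟨hgreat, by linarith, fun h => ⟨?_, ?_, by linarith⟩, fun ⟨h₁, h₂, h₃⟩ => ?_⟩
  · have h₀ := le_antisymm (by linarith) hQ
    intro a b
    have ha := (Finset.sum_eq_zero_iff_of_nonneg fun a _ => hQ₀ a).1 h₀ a (Finset.mem_univ a)
    have hb := (Finset.sum_eq_zero_iff_of_nonneg fun b _ => sq_nonneg _).1 ha b
      (Finset.mem_univ b)
    exact norm_eq_zero.1 (pow_eq_zero_iff two_ne_zero |>.1 hb)
  · have h₀ : ‖H₁ - H₂‖ ^ 2 = 0 := le_antisymm (by linarith) hN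
    exact sub_eq_zero.1 (norm_eq_zero.1 (pow_eq_zero_iff two_ne_zero |>.1 h₀))
  · simp only [h₁, norm_zero, ne_eq, OfNat.ofNat_ne_zero, not_false_eq_true, zero_pow,
      Finset.sum_const_zero]
    rw [h₂, sub_self, norm_zero] at hsub
    rw [h₂] at hadd
    rw [h₂, h₃]
    linarith
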